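/- All graphs are finite and simple. An identification of two distinct vertices $u,v$ of a graph replaces them by a new vertex that is adjacent to all other vertices that were adjacent to $u$ or to $v$. For a class $\mathcal H$ of graphs, the problem $\mathcal H$-Identification asks, for a graph $G$ and an integer $k\ge 0$, whether at most $k$ successive identifications transform $G$ into a graph of $\mathcal H$. Forest-Identification and Tree-Identification are the cases where $\mathcal H$ is the class of forests and the class of trees (a tree is a connected, acyclic graph with at least one vertex). A kernel with $\mathcal O(k^3)$ vertices is a polynomial-time algorithm that maps each instance $(G,k)$ to an instance $(G',k')$ of the same problem that is a yes-instance if and only if $(G,k)$ is one, with $|V(G')|\le f(k)$ for some function $f(k)=\mathcal O(k^3)$, and with $k'\le k$. **Theorem.** 1. Forest-Identification, parameterized by $k$, admits a kernel with $\mathcal O(k^3)$ vertices. 2. Tree-Identification, parameterized by $k$, admits a kernel with $\mathcal O(k^3)$ vertices. 3. The following reduction rules are safe for Forest-Identification. (a) Deleting a bridge of $G$, or an isolated vertex of $G$, and keeping $k$, gives an equivalent instance. (b) If two distinct vertices $u,v$ of $G$ have more than $k+1$ common neighbours, then $(G,k)$ is a yes-instance if and only if $k\ge 1$ and $(G',k-1)$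 is a yes-instance, where $G'$ is obtained from $G$ by identifying $u$ and $v$. 4. If $(G,k)$ is a yes-instance of Forest-Identification to which none of these rules applies, that is, $G$ has no bridges, no isolated vertices, and no two distinct vertices with more than $k+1$ common neighbours, then $|V(G)|\le 2k+(k+1)\binom{2k}{2}$. -/

import Mathlib

namespace IdKernel

/-! ## Vertex identification -/

/-- The graph obtained from `G` by identifying `u` and `v`: the vertex `v` disappears and `u` plays
the role of the new vertex, adjacent to every other vertex that was adjacent to `u` or to `v`. -/
def identify {V : Type} (G : SimpleGraph V) (u v : V) : SimpleGraph {x : V // x ≠ v} where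
  Adj x y := x ≠ y ∧
    (G.Adj x y ∨ ((x : V) = u ∧ G.Adj v y) ∨ ((y : V) = u ∧ G.Adj x v))
  symm := ⟨by
    rintro x y ⟨hne, h | ⟨h, h'⟩ | ⟨h, h'⟩⟩
    · exact ⟨hne.symm, Or.inl h.symm⟩
    · exact ⟨hne.symm, Or.inr (Or.inr ⟨h, h'.symm⟩)⟩
    · exact ⟨hne.symm, Or.inr (Or.inl ⟨h, h'.symm⟩)⟩⟩
  loopless := ⟨fun _ h => h.1 rfl⟩

/-- `Identifiable H k G`: at most `k` successive vertex identifications, each one of two distinct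
vertices of the current graph, transform `G` into a graph of the class `H`. -/
def Identifiable (H : ∀ V : Type, SimpleGraph V → Prop) : ℕ → ∀ V : Type, SimpleGraph V → Prop
  | 0, V, G => H V G
  | k + 1, V, G => H V G ∨ ∃ u v : V, u ≠ v ∧ Identifiable H k {x : V // x ≠ v} (identify G u v)

/-- The class of forests. -/
def Forest (V : Type) (G : SimpleGraph V) : Prop := G.IsAcyclic

/-- The class of trees. -/
def Tree (V : Type) (G : SimpleGraph V) : Prop := G.IsTree

/-- An instance `(G, k)`: a finite graph, with vertex set `{0, …, n - 1}`, and the parameter. -/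
structure Instance where
  n : ℕ
  graph : SimpleGraph (Fin n)
  k : ℕ

/-- The decision problem `H`-Identification, as the set of its yes-instances. -/
def IdentificationProblem (H : ∀ V : Type, SimpleGraph V → Prop) : Set Instance :=
  {I | Identifiable H I.k (Fin I.n) I.graph}

/-! ## Random access machines with unit costs

Programs use finitely many integer variables and finitely many one-dimensional arrays, with indirect
addressing. The arithmetic operations are addition and truncated subtraction (there is no
multiplication), so that unit costs are polynomially equivalent to the number of steps of a Turing
machine. -/

/-- The memory: the values of the variables, and the entries of the arrays. -/
structure Store where
  var : ℕ → ℕ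
  arr : ℕ → ℕ → ℕ

/-- Expressions. `get a e` is the entry of array number `a` at the index given by `e`. -/
inductive Expr where
  | const (c : ℕ)
  | var (x : ℕ)
  | add (e₁ e₂ : Expr)
  | sub (e₁ e₂ : Expr)
  | get (a : ℕ) (e : Expr)

/-- The value of an expression. -/
def Expr.eval (s : Store) : Expr → ℕ
  | const c => c
  | var x => s.var x
  | add e₁ e₂ => e₁.eval s + e₂.eval s
  | sub e₁ e₂ => e₁.eval s - e₂.eval s
  | get a e => s.arr a (e.eval s)

/-- The number of steps needed to evaluate an expression: one for each operation, constant and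
variable in it. -/
def Expr.cost : Expr → ℕ
  | const _ => 1
  | var _ => 1
  | add e₁ e₂ => e₁.cost + e₂.cost + 1
  | sub e₁ e₂ => e₁.cost + e₂.cost + 1
  | get _ e => e.cost + 1

/-- Programs. A condition is an expression, which is true if its value is not `0`. -/
inductive Prog where
  | skip
  | assign (x : ℕ) (e : Expr)
  | put (a : ℕ) (i e : Expr)
  | seq (P Q : Prog)
  | ite (e : Expr) (P Q : Prog)
  | while (e : Expr) (P : Prog)

/-- The store after the assignment of the value `c` to the variable `x`. -/
def Store.setVar (s : Store) (x c : ℕ) : Store :=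
  { s with var := Function.update s.var x c }

/-- The store after the assignment of the value `c` to the entry at index `i` of the array `a`. -/
def Store.setArr (s : Store) (a i c : ℕ) : Store :=
  { s with arr := Function.update s.arr a (Function.update (s.arr a) i c) }

/-- `Exec P s s' t`: started in the store `s`, the program `P` halts after exactly `t` steps, in
the store `s'`. -/
inductive Exec : Prog → Store → Store → ℕ → Prop where
  | skip (s : Store) : Exec .skip s s 1
  | assign (x : ℕ) (e : Expr) (s : Store) :
      Exec (.assign x e) s (s.setVar x (e.eval s)) (e.cost + 1)
  | put (a : ℕ) (i e : Expr) (s : Store) :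
      Exec (.put a i e) s (s.setArr a (i.eval s) (e.eval s)) (i.cost + e.cost + 1)
  | seq {P Q : Prog} {s s' s'' : Store} {t t' : ℕ} :
      Exec P s s' t → Exec Q s' s'' t' → Exec (.seq P Q) s s'' (t + t')
  | ite_true {e : Expr} {P Q : Prog} {s s' : Store} {t : ℕ} :
      e.eval s ≠ 0 → Exec P s s' t → Exec (.ite e P Q) s s' (e.cost + 1 + t)
  | ite_false {e : Expr} {P Q : Prog} {s s' : Store} {t : ℕ} :
      e.eval s = 0 → Exec Q s s' t → Exec (.ite e P Q) s s' (e.cost + 1 + t)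
  | while_true {e : Expr} {P : Prog} {s s' s'' : Store} {t t' : ℕ} :
      e.eval s ≠ 0 → Exec P s s' t → Exec (.while e P) s' s'' t' →
        Exec (.while e P) s s'' (e.cost + 1 + t + t')
  | while_false {e : Expr} {P : Prog} {s : Store} :
      e.eval s = 0 → Exec (.while e P) s s (e.cost + 1)

open Classical in
/-- The input store of an instance: variable `0` holds the number `n` of vertices, variable `1`
holds the parameter, array `0` holds the adjacency matrix row by row (the entry for the pair `i, j`
is at index `i * n + j`), and everything else is `0`. -/
noncomputable def Instance.store (I : Instance) : Store where
  var x := if x = 0 then I.n else if x = 1 then I.k else 0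
  arr a c :=
    if a = 0 ∧ ∃ i j : Fin I.n, c = (i : ℕ) * I.n + j ∧ I.graph.Adj i j then 1 else 0

/-- A store represents an instance, as an output: number of vertices, parameter and adjacency matrix
are where they are in the input store, and all other variables and entries are arbitrary. -/
def Represents (s : Store) (I : Instance) : Prop :=
  s.var 0 = I.n ∧ s.var 1 = I.k ∧ ∀ c < I.n * I.n, s.arr 0 c = I.store.arr 0 c

/-- The length of the encoding of an instance: the adjacency matrix, and the parameter in binary. -/
def Instance.size (I : Instance) : ℕ := I.n * I.n + Nat.size I.k

/-- The transformation `A` of instances can be computed in polynomial time. -/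
def PolyTime (A : Instance → Instance) : Prop :=
  ∃ (P : Prog) (p : Polynomial ℕ), ∀ I : Instance, ∃ (s : Store) (t : ℕ),
    Exec P I.store s t ∧ t ≤ p.eval I.size ∧ Represents s (A I)

/-! ## Kernels -/

/-- `A` is a kernelization algorithm for the parameterized problem `L`, whose kernels have at most
`f k` vertices: it runs in polynomial time and maps each instance to an equivalent one, with at most
`f k` vertices, without increasing the parameter. -/
structure IsKernelization (L : Set Instance) (f : ℕ → ℕ) (A : Instance → Instance) : Prop where
  polyTime : PolyTime A
  equivalent : ∀ I, A I ∈ L ↔ I ∈ L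
  card_le : ∀ I, (A I).n ≤ f I.k
  param_le : ∀ I, (A I).k ≤ I.k

/-- `L` admits a kernel with `O(g(k))` vertices. -/
def AdmitsKernelWithVertices (L : Set Instance) (g : ℕ → ℝ) : Prop :=
  ∃ f : ℕ → ℕ, ((fun k => (f k : ℝ)) =O[Filter.atTop] g) ∧ ∃ A, IsKernelization L f A

/-! ## The reduction rules for forests -/

/-- No reduction rule applies to `(G, k)`: there are no bridges and no isolated vertices, and no two
vertices have more than `k + 1` common neighbours. (`SimpleGraph.IsBridge` does not ask that its
argument is an edge.) -/
structure IsReduced {V : Type} (G : SimpleGraph V) (k : ℕ) : Prop where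
  no_bridge : ∀ e ∈ G.edgeSet, ¬ G.IsBridge e
  no_isolated : ∀ v, ¬ G.IsIsolated v
  common_le : ∀ u v, u ≠ v → (G.commonNeighbors u v).encard ≤ k + 1

end IdKernel

/-!
Up to isomorphism, the graphs obtained from `G` by at most `k` identifications are the quotients
`G.map f`, for surjective maps `f` that save at most `k` vertices (`identifiable_iff`); for forests,
`f` need not be surjective (`forest_iff`). Everything about identifications is shown for such
quotients.

*Rules.* A bridge can be deleted because the classes of `f` can be split along the two sides of the
bridge without creating cycles (`isAcyclic_map_prod`, `forest_sup_edge_iff`). Two vertices with more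
than `k + 1` common neighbours have the same image in every acyclic quotient that saves at most `k`
vertices, because two vertices of a forest have at most one common neighbour
(`eq_of_common_neighbors`).

*Size.* If there are no bridges, then each edge `w y` at a vertex `w` that is alone in its class
lies on a cycle, whose image in the forest must use the image of `w y` twice. So `w` has two
neighbours in the class of `y` (`exists_adj_adj_of_no_bridge`). The at most `2 k` vertices in
nontrivial classes have at most `(2 k).choose 2` pairs, and each pair has at most `k + 1` common
neighbours (`card_nonisolated_le`).

*Trees.* A graph with `c` components can be turned into a tree by `k` identifications if and only
if it has a vertex, `c ≤ k + 1`, and `k + 1 - c` identifications suffice to turn it into a forest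
(`tree_iff_forest`). Both directions count edges of connected graphs. In particular the two problems
agree on connected graphs.

*Algorithm.* Loop programs, with a functional semantics `LoopProg.run` and loops over all vertices
only, compile to programs of the random access machine that run in polynomial time
(`LoopProg.exec_compile`), so that only their results have to be verified. The program `coreProg`
applies the rules exhaustively on a fixed vertex set, where an identification leaves an isolated
vertex behind (`merge`). Each of `n ^ 2` sweeps over all pairs of vertices lowers the number of
edges, unless no rule applies. Then vertex `0` is joined to every component that has an edge, each
time by a bridge, and the component of vertex `0` is relabelled and written out, or a triangle with
the parameter `0` if too many vertices are left (`coreProg_spec`). The output for a nonempty graph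
is connected, so it serves for both problems; for trees, the number of components is computed
first, and the parameter is reduced accordingly.
-/

namespace IdKernel

/-! ### Identifications as quotient maps -/

theorem map_map_fun {V W X : Type} (G : SimpleGraph V) (f : V → W) (g : W → X) :
    (G.map f).map g = G.map (g ∘ f) := by
  ext a b
  simp only [SimpleGraph.map, Relation.Map, Pi.inf_apply, inf_Prop_eq, Function.comp_apply]
  constructor
  · rintro ⟨hne, _, _, ⟨_, x, y, h, rfl, rfl⟩, rfl, rfl⟩
    exact ⟨hne, x, y, h, rfl, rfl⟩
  · rintro ⟨hne, x, y, h, rfl, rfl⟩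
    exact ⟨hne, f x, f y, ⟨fun e => hne (congrArg g e), x, y, h, rfl, rfl⟩, rfl, rfl⟩

theorem map_fun_adj {V W : Type} {G : SimpleGraph V} {f : V → W} {a b : W} :
    (G.map f).Adj a b ↔ a ≠ b ∧ ∃ x y, G.Adj x y ∧ f x = a ∧ f y = b := Iff.rfl

open Classical in
/-- The map that sends `v` to `u` and fixes the other vertices. -/
noncomputable def collapse {V : Type} {u v : V} (h : u ≠ v) (x : V) : {x : V // x ≠ v} :=
  if hx : x = v then ⟨u, h⟩ else ⟨x, hx⟩

theorem collapse_self {V : Type} {u v : V} (h : u ≠ v) : collapse h v = ⟨u, h⟩ := by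
  simp [collapse]

theorem collapse_of_ne {V : Type} {u v x : V} (h : u ≠ v) (hx : x ≠ v) :
    collapse h x = ⟨x, hx⟩ := by
  simp [collapse, hx]

theorem identify_eq_map {V : Type} (G : SimpleGraph V) {u v : V} (h : u ≠ v) :
    identify G u v = G.map (collapse h) := by
  ext ⟨x, hx⟩ ⟨y, hy⟩
  rw [map_fun_adj]
  simp only [identify]
  refine and_congr_right fun hne => ⟨?_, ?_⟩
  · rintro (h1 | ⟨rfl, h1⟩ | ⟨rfl, h1⟩)
    · exact ⟨x, y, h1, collapse_of_ne h hx, collapse_of_ne h hy⟩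
    · exact ⟨v, y, h1, collapse_self h, collapse_of_ne h hy⟩
    · exact ⟨x, v, h1, collapse_of_ne h hx, collapse_self h⟩
  · rintro ⟨a, b, hab, ha, hb⟩
    by_cases hav : a = v <;> by_cases hbv : b = v
    · subst hav; subst hbv; exact (hab.ne rfl).elim
    · subst hav
      rw [collapse_self, Subtype.mk.injEq] at ha
      rw [collapse_of_ne h hbv, Subtype.mk.injEq] at hb
      subst ha; subst hb; exact Or.inr (Or.inl ⟨rfl, hab⟩)
    · subst hbv
      rw [collapse_self, Subtype.mk.injEq] at hb
      rw [collapse_of_ne h hav, Subtype.mk.injEq] at ha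
      subst ha; subst hb; exact Or.inr (Or.inr ⟨rfl, hab⟩)
    · rw [collapse_of_ne h hav, Subtype.mk.injEq] at ha
      rw [collapse_of_ne h hbv, Subtype.mk.injEq] at hb
      subst ha; subst hb; exact Or.inl hab

theorem collapse_surjective {V : Type} {u v : V} (h : u ≠ v) :
    Function.Surjective (collapse h) := fun x => ⟨x, collapse_of_ne h x.2⟩

theorem card_subtype_ne {V : Type} [Finite V] (v : V) :
    Nat.card {x : V // x ≠ v} + 1 = Nat.card V := by
  classical
  have := Fintype.ofFinite V
  have : 0 < Fintype.card V := Fintype.card_pos_iff.mpr ⟨v⟩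
  simp only [Nat.card_eq_fintype_card, ne_eq, Fintype.card_subtype_compl, Fintype.card_subtype_eq]
  omega

/-- A quotient map factors through every identification of two vertices with the same image. -/
theorem map_identify {V W : Type} (G : SimpleGraph V) {u v : V} (h : u ≠ v) {f : V → W}
    (huv : f u = f v) : (identify G u v).map (fun x : {x : V // x ≠ v} => f x) = G.map f := by
  rw [identify_eq_map G h, map_map_fun]
  congr 1
  funext x
  by_cases hx : x = v
  · subst hx; simp [collapse_self, huv]
  · simp [collapse_of_ne h hx]

/-- For a class closed under isomorphism, `k` identifications lead into the class if and only if
there is a quotient of the graph in the class which has at most `k` vertices fewer. -/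
theorem identifiable_iff {H : ∀ V : Type, SimpleGraph V → Prop}
    (hH : ∀ {V W : Type} {G : SimpleGraph V} {G' : SimpleGraph W}, G ≃g G' → H V G → H W G')
    {V : Type} [Finite V] (G : SimpleGraph V) (k : ℕ) :
    Identifiable H k V G ↔ ∃ (W : Type) (f : V → W), Function.Surjective f ∧
      Nat.card V ≤ Nat.card W + k ∧ H W (G.map f) := by
  have base : ∀ {V : Type} (G : SimpleGraph V) (k : ℕ), H V G → ∃ (W : Type) (f : V → W),
      Function.Surjective f ∧ Nat.card V ≤ Nat.card W + k ∧ H W (G.map f) := fun {V} G k h =>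
    ⟨V, id, Function.surjective_id, Nat.le_add_right _ _, by
      have : G.map id = G := by simp
      rwa [this]⟩
  have inj : ∀ {V : Type} {G : SimpleGraph V} {W : Type} {f : V → W}, Function.Surjective f →
      Function.Injective f → H W (G.map f) → H V G := fun {V G W f} hs hi h =>
    hH (SimpleGraph.Iso.map (Equiv.ofBijective f ⟨hi, hs⟩) G).symm h
  induction k generalizing V with
  | zero =>
    refine ⟨base G 0, ?_⟩
    rintro ⟨W, f, hs, hc, h⟩
    have hW : Finite W := Finite.of_surjective f hs
    have hb : Function.Bijective f := by
      rw [Nat.bijective_iff_surjective_and_card]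
      exact ⟨hs, le_antisymm hc (Nat.card_le_card_of_surjective f hs)⟩
    exact inj hs hb.1 h
  | succ k ih =>
    constructor
    · rintro (h | ⟨u, v, huv, h⟩)
      · exact base G _ h
      · obtain ⟨W, f, hs, hc, h⟩ := (ih _).1 h
        refine ⟨W, f ∘ collapse huv, hs.comp (collapse_surjective huv), ?_, ?_⟩
        · have := card_subtype_ne v
          omega
        · rwa [← map_map_fun, ← identify_eq_map]
    · rintro ⟨W, f, hs, hc, h⟩
      by_cases hi : Function.Injective f
      · exact Or.inl (inj hs hi h)
      · simp only [Function.Injective, not_forall] at hi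
        obtain ⟨u, v, he, hne⟩ := hi
        refine Or.inr ⟨u, v, hne, (ih _).2 ⟨W, fun x => f x, ?_, ?_, ?_⟩⟩
        · intro w
          obtain ⟨x, rfl⟩ := hs w
          by_cases hx : x = v
          · exact ⟨⟨u, hne⟩, by rw [hx, ← he]⟩
          · exact ⟨⟨x, hx⟩, rfl⟩
        · have := card_subtype_ne v
          omega
        · rwa [map_identify G hne he]

/-! ### Reachability and acyclicity -/

/-- A property that passes along edges passes along reachability. -/
theorem reachable_induct {V : Type} {G : SimpleGraph V} {P : V → Prop} {u v : V}
    (h : G.Reachable u v) (hu : P u) (hstep : ∀ x y, G.Adj x y → P x → P y) : P v := by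
  obtain ⟨p⟩ := h
  induction p with
  | nil => exact hu
  | cons hadj _ ih => exact ih (hstep _ _ hadj hu)

/-- A graph is acyclic if it maps to an acyclic graph, edges to edges, so that no two vertices of
the same component have the same image. -/
theorem isAcyclic_of_map {V W : Type} {G : SimpleGraph V} {Q : SimpleGraph W} (φ : V → W)
    (hQ : Q.IsAcyclic) (hadj : ∀ a b, G.Adj a b → Q.Adj (φ a) (φ b))
    (hinj : ∀ a b, G.Reachable a b → φ a = φ b → a = b) : G.IsAcyclic := by
  rw [SimpleGraph.isAcyclic_iff_forall_adj_isBridge] at hQ ⊢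
  intro a b hab
  rw [SimpleGraph.isBridge_iff]
  intro hr
  refine (SimpleGraph.isBridge_iff.1 (hQ (hadj a b hab))) ?_
  refine (reachable_induct (P := fun p => G.Reachable a p ∧
    (Q.deleteEdges {s(φ a, φ b)}).Reachable (φ a) (φ p)) hr ⟨.rfl, .rfl⟩ ?_).2
  rintro x y hxy ⟨h1, h2⟩
  rw [SimpleGraph.deleteEdges_adj] at hxy
  have h3 : G.Reachable a y := h1.trans hxy.1.reachable
  refine ⟨h3, h2.trans (SimpleGraph.Adj.reachable ?_)⟩
  rw [SimpleGraph.deleteEdges_adj]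
  refine ⟨hadj _ _ hxy.1, fun he => hxy.2 ?_⟩
  have hb : G.Reachable a b := hab.reachable
  rw [Set.mem_singleton_iff, Sym2.eq_iff] at he ⊢
  rcases he with ⟨h4, h5⟩ | ⟨h4, h5⟩
  · exact Or.inl ⟨hinj _ _ h1.symm h4, hinj _ _ (h3.symm.trans hb) h5⟩
  · exact Or.inr ⟨hinj _ _ (h1.symm.trans hb) h4, hinj _ _ h3.symm h5⟩

theorem IsAcyclic.map_anti {V W : Type} {G G' : SimpleGraph V} (h : G ≤ G') {f : V → W}
    (hf : (G'.map f).IsAcyclic) : (G.map f).IsAcyclic :=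
  hf.anti fun _ _ => by
    rintro ⟨hne, x, y, hxy, hx, hy⟩
    exact ⟨hne, x, y, h hxy, hx, hy⟩

/-- Forest-Identification in terms of maps that need not be surjective. -/
theorem forest_iff {V : Type} [Finite V] (G : SimpleGraph V) (k : ℕ) :
    Identifiable Forest k V G ↔ ∃ (W : Type) (f : V → W),
      Nat.card V ≤ Nat.card (Set.range f) + k ∧ (G.map f).IsAcyclic := by
  rw [identifiable_iff (H := Forest) fun e h => e.isAcyclic_iff.1 h]
  constructor
  · rintro ⟨W, f, hs, hc, h⟩
    refine ⟨W, f, ?_, h⟩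
    rwa [Set.range_eq_univ.2 hs, Nat.card_univ]
  · rintro ⟨W, f, hc, h⟩
    refine ⟨Set.range f, Set.rangeFactorization f, Set.rangeFactorization_surjective, hc, ?_⟩
    refine isAcyclic_of_map Subtype.val h ?_ fun a b _ => Subtype.ext
    rintro a b ⟨hne, x, y, hxy, rfl, rfl⟩
    exact ⟨fun e => hne (Subtype.ext e), x, y, hxy, rfl, rfl⟩

theorem tree_iff {V : Type} [Finite V] (G : SimpleGraph V) (k : ℕ) :
    Identifiable Tree k V G ↔ ∃ (W : Type) (f : V → W), Function.Surjective f ∧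
      Nat.card V ≤ Nat.card W + k ∧ (G.map f).IsTree :=
  identifiable_iff (H := Tree) (fun e h => e.isTree_iff.1 h) G k

/-! ### Safety of the reduction rules -/

theorem card_range_le_of_factor {V W X : Type} [Finite V] (f : V → W) (g : V → X) (h : X → W)
    (hf : ∀ x, f x = h (g x)) : Nat.card (Set.range f) ≤ Nat.card (Set.range g) := by
  have : Set.range f = h '' Set.range g := by
    rw [← Set.range_comp]; exact congrArg _ (funext hf)
  rw [this, Nat.card_coe_set_eq, Nat.card_coe_set_eq]
  exact Set.ncard_image_le (Set.finite_range g)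

theorem Identifiable.forest_anti {V : Type} [Finite V] {G G' : SimpleGraph V} {k : ℕ} (h : G ≤ G')
    (hG : Identifiable Forest k V G') : Identifiable Forest k V G := by
  rw [forest_iff] at hG ⊢
  obtain ⟨W, f, hc, ha⟩ := hG
  exact ⟨W, f, hc, IsAcyclic.map_anti h ha⟩

/-- Splitting the classes of a partition by the values of a function that is constant along edges
keeps the quotient acyclic. -/
theorem isAcyclic_map_prod {V W X : Type} {G : SimpleGraph V} {f : V → W} (p : V → X)
    (hp : ∀ x y, G.Adj x y → p x = p y) (h : (G.map f).IsAcyclic) :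
    (G.map fun x => (f x, p x)).IsAcyclic := by
  have hsnd : ∀ a b, (G.map fun x => (f x, p x)).Adj a b → a.2 = b.2 := by
    rintro a b ⟨-, x, y, hxy, rfl, rfl⟩
    exact hp x y hxy
  refine isAcyclic_of_map Prod.fst h ?_ ?_
  · rintro a b hab
    have h2 := hsnd a b hab
    obtain ⟨hne, x, y, hxy, rfl, rfl⟩ := hab
    exact ⟨fun e => hne (Prod.ext e h2), x, y, hxy, rfl, rfl⟩
  · intro a b hab he
    exact Prod.ext he (reachable_induct (P := fun c => a.2 = c.2) hab rfl
      fun x y hxy hx => hx.trans (hsnd x y hxy))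

/-- Joining two vertices of different components by an edge changes nothing: a partition can be
split along the component of one of them. -/
theorem forest_sup_edge_iff {V : Type} [Finite V] (G : SimpleGraph V) (k : ℕ) {x y : V}
    (hxy : ¬ G.Reachable x y) :
    Identifiable Forest k V (G ⊔ SimpleGraph.edge x y) ↔ Identifiable Forest k V G := by
  refine ⟨Identifiable.forest_anti le_sup_left, fun h => ?_⟩
  rw [forest_iff] at h ⊢
  obtain ⟨W, f, hc, ha⟩ := h
  let p : V → Prop := fun z => G.Reachable x z
  have hp : ∀ a b, G.Adj a b → p a = p b := fun a b hab =>
    propext ⟨fun h => h.trans hab.reachable, fun h => h.trans hab.symm.reachable⟩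
  let g : V → W × Prop := fun z => (f z, p z)
  refine ⟨W × Prop, g, ?_, ?_⟩
  · have := card_range_le_of_factor f g Prod.fst fun _ => rfl
    omega
  · have h1 : (G.map g).IsAcyclic := isAcyclic_map_prod p hp ha
    have h2 : ¬ (G.map g).Reachable (g x) (g y) := fun hr => by
      have : (g y).2 := reachable_induct (P := fun c => c.2) hr SimpleGraph.Reachable.rfl
        fun a b hab ha' => by
          obtain ⟨-, u, v, huv, rfl, rfl⟩ := hab
          exact (hp u v huv).mp ha'
      exact hxy this
    refine (h1.sup_edge_of_not_reachable h2).anti ?_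
    rintro a b ⟨hne, u, v, huv, rfl, rfl⟩
    rw [SimpleGraph.sup_adj] at huv ⊢
    rcases huv with huv | huv
    · exact Or.inl ⟨hne, u, v, huv, rfl, rfl⟩
    · rw [SimpleGraph.edge_adj] at huv
      rw [SimpleGraph.edge_adj]
      refine Or.inr ⟨?_, hne⟩
      rcases huv.1 with ⟨rfl, rfl⟩ | ⟨rfl, rfl⟩
      · exact Or.inl ⟨rfl, rfl⟩
      · exact Or.inr ⟨rfl, rfl⟩

theorem deleteEdges_sup_edge {V : Type} {G : SimpleGraph V} {x y : V} (h : G.Adj x y) :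
    G.deleteEdges {s(x, y)} ⊔ SimpleGraph.edge x y = G := by
  ext a b
  simp only [SimpleGraph.sup_adj, SimpleGraph.deleteEdges_adj, SimpleGraph.edge_adj,
    Set.mem_singleton_iff, Sym2.eq_iff]
  constructor
  · rintro (h1 | ⟨⟨rfl, rfl⟩ | ⟨rfl, rfl⟩, -⟩)
    exacts [h1.1, h, h.symm]
  · intro h1
    by_cases h2 : a = x ∧ b = y ∨ a = y ∧ b = x
    · exact Or.inr ⟨by tauto, h1.ne⟩
    · exact Or.inl ⟨h1, h2⟩

theorem forest_deleteEdges_iff {V : Type} [Finite V] (G : SimpleGraph V) (k : ℕ) {e : Sym2 V}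
    (he : e ∈ G.edgeSet) (hb : G.IsBridge e) :
    Identifiable Forest k V G ↔ Identifiable Forest k V (G.deleteEdges {e}) := by
  induction e with
  | _ x y =>
    rw [SimpleGraph.isBridge_iff] at hb
    have := forest_sup_edge_iff _ k hb
    rwa [deleteEdges_sup_edge he] at this

/-- On a set of vertices a partition identifies at most as much as on the whole graph. -/
theorem card_le_card_image_add {V W : Type} [Finite V] {f : V → W} {k : ℕ}
    (hc : Nat.card V ≤ Nat.card (Set.range f) + k) (S : Set V) :
    S.ncard ≤ (f '' S).ncard + k := by
  have h1 : (Set.range f).ncard ≤ (f '' S).ncard + (f '' Sᶜ).ncard := by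
    rw [← Set.image_univ, ← Set.union_compl_self S, Set.image_union]
    exact Set.ncard_union_le _ _
  have h2 : (f '' Sᶜ).ncard ≤ Sᶜ.ncard := Set.ncard_image_le (Set.toFinite _)
  have h3 := Set.ncard_add_ncard_compl S
  rw [Nat.card_coe_set_eq] at hc
  omega

/-- Isolated vertices can be removed, any number of them at once. -/
theorem forest_induce_iff {V : Type} [Finite V] (G : SimpleGraph V) (k : ℕ) (S : Set V)
    (hS : ∀ v ∉ S, G.IsIsolated v) :
    Identifiable Forest k V G ↔ Identifiable Forest k S (G.induce S) := by
  rw [forest_iff, forest_iff]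
  constructor
  · rintro ⟨W, f, hc, ha⟩
    refine ⟨W, fun x => f x, ?_, ?_⟩
    · have := card_le_card_image_add hc S
      rw [Nat.card_coe_set_eq, Nat.card_coe_set_eq]
      rwa [Set.image_eq_range] at this
    · refine ha.anti ?_
      rintro a b ⟨hne, x, y, hxy, rfl, rfl⟩
      exact ⟨hne, x, y, hxy, rfl, rfl⟩
  · rintro ⟨W, f, hc, ha⟩
    by_cases hne : Nonempty S
    swap
    · have hG : G = ⊥ := by
        ext a b
        simpa using hS a (fun h => hne ⟨⟨a, h⟩⟩) b
      refine ⟨V, id, ?_, ?_⟩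
      · rw [Set.range_id, Nat.card_univ]; omega
      · rw [SimpleGraph.map_id, hG]; exact SimpleGraph.isAcyclic_bot
    obtain ⟨s0⟩ := hne
    classical
    let g : V → W ⊕ V := fun x => if h : x ∈ S then Sum.inl (f ⟨x, h⟩) else Sum.inr x
    have hg1 : ∀ x : S, g x = Sum.inl (f x) := fun x => by simp [g]
    have hg2 : ∀ x ∉ S, g x = Sum.inr x := fun x hx => by simp [g, hx]
    have hmem : ∀ x y, G.Adj x y → x ∈ S := fun x y hxy => by
      by_contra hx; exact hS x hx y hxy
    have hadj : ∀ a b, (G.map g).Adj a b → ∃ c d, a = Sum.inl c ∧ b = Sum.inl d ∧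
        ((G.induce S).map f).Adj c d := by
      rintro a b ⟨hne, x, y, hxy, rfl, rfl⟩
      have hx := hmem x y hxy
      have hy := hmem y x hxy.symm
      refine ⟨_, _, hg1 ⟨x, hx⟩, hg1 ⟨y, hy⟩, ?_, ⟨x, hx⟩, ⟨y, hy⟩, hxy, rfl, rfl⟩
      intro he
      rw [hg1 ⟨x, hx⟩, hg1 ⟨y, hy⟩, he] at hne
      exact hne rfl
    refine ⟨W ⊕ V, g, ?_, ?_⟩
    · have hcS := Nat.card_coe_set_eq S
      have hcf := Nat.card_coe_set_eq (Set.range f)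
      rw [Nat.card_coe_set_eq]
      have h1 : Set.range g = Sum.inl '' Set.range f ∪ Sum.inr '' Sᶜ := by
        ext a
        constructor
        · rintro ⟨x, rfl⟩
          by_cases hx : x ∈ S
          · exact Or.inl ⟨_, ⟨⟨x, hx⟩, rfl⟩, (hg1 ⟨x, hx⟩).symm⟩
          · exact Or.inr ⟨x, hx, (hg2 x hx).symm⟩
        · rintro (⟨_, ⟨x, rfl⟩, rfl⟩ | ⟨x, hx, rfl⟩)
          · exact ⟨x, hg1 x⟩
          · exact ⟨x, hg2 x hx⟩
      have h2 : Disjoint (Sum.inl '' Set.range f : Set (W ⊕ V)) (Sum.inr '' Sᶜ) := by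
        rw [Set.disjoint_left]
        rintro _ ⟨a, -, rfl⟩ ⟨b, -, h⟩
        cases h
      rw [h1, Set.ncard_union_eq h2 ((Set.finite_range f).image _) (Set.toFinite _),
        Set.ncard_image_of_injective _ Sum.inl_injective,
        Set.ncard_image_of_injective _ Sum.inr_injective, ← Set.ncard_add_ncard_compl S]
      omega
    · refine isAcyclic_of_map (Sum.elim id fun _ => f s0) ha ?_ ?_
      · intro a b hab
        obtain ⟨c, d, rfl, rfl, h⟩ := hadj a b hab
        exact h
      · intro a b hab he
        rcases eq_or_ne a b with h | h
        · exact h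
        have ha' : ∃ c, a = Sum.inl c := by
          obtain ⟨w, hw⟩ := hab.nonempty_neighborSet_left h
          obtain ⟨c, d, hc, hd, -⟩ := hadj _ _ hw
          exact ⟨c, hc⟩
        have hb' : ∃ c, b = Sum.inl c := by
          obtain ⟨w, hw⟩ := hab.nonempty_neighborSet_right h
          obtain ⟨c, d, hc, hd, -⟩ := hadj _ _ hw
          exact ⟨c, hc⟩
        obtain ⟨c, rfl⟩ := ha'
        obtain ⟨d, rfl⟩ := hb'
        exact congrArg Sum.inl he

/-- In a forest, two distinct vertices have at most one common neighbour. -/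
theorem isAcyclic_common_neighbor_unique {W : Type} {Q : SimpleGraph W} (hQ : Q.IsAcyclic)
    {u v a b : W} (huv : u ≠ v) (ha : Q.Adj u a) (ha' : Q.Adj v a) (hb : Q.Adj u b)
    (hb' : Q.Adj v b) : a = b := by
  by_contra hab
  rw [SimpleGraph.isAcyclic_iff_forall_adj_isBridge] at hQ
  have h := hQ ha
  rw [SimpleGraph.isBridge_iff] at h
  have step : ∀ x y, Q.Adj x y → s(x, y) ≠ s(u, a) →
      (Q.deleteEdges {s(u, a)}).Reachable x y := fun x y hxy hne =>
    SimpleGraph.Adj.reachable (by rw [SimpleGraph.deleteEdges_adj]; exact ⟨hxy, hne⟩)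
  refine h (((step u b hb ?_).trans (step b v hb'.symm ?_)).trans (step v a ha' ?_))
  · rw [Ne, Sym2.eq_iff]
    rintro (⟨-, h⟩ | ⟨h, -⟩)
    exacts [hab h.symm, ha.ne h]
  · rw [Ne, Sym2.eq_iff]
    rintro (⟨h, -⟩ | ⟨h, -⟩)
    exacts [hb.ne h.symm, hab h.symm]
  · rw [Ne, Sym2.eq_iff]
    rintro (⟨h, -⟩ | ⟨h, -⟩)
    exacts [huv h.symm, ha'.ne h]

/-- Two vertices with more than `k + 1` common neighbours have the same image in every acyclic
quotient that saves at most `k` vertices: otherwise the images of the common neighbours other than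
those of `u` and `v` agree, so that `u`, `v` and their common neighbours have at most three
images. -/
theorem eq_of_common_neighbors {V W : Type} [Finite V] {G : SimpleGraph V} {f : V → W} {k : ℕ}
    {u v : V} (hc : Nat.card V ≤ Nat.card (Set.range f) + k) (ha : (G.map f).IsAcyclic)
    (huv : u ≠ v) (hk : k + 1 < (G.commonNeighbors u v).ncard) : f u = f v := by
  by_contra hf
  set C := G.commonNeighbors u v with hC
  have hD : (insert u (insert v C)).ncard = C.ncard + 2 := by
    rw [Set.ncard_insert_of_notMem, Set.ncard_insert_of_notMem]
    · exact fun h => (G.loopless.irrefl v h.2)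
    · rw [Set.mem_insert_iff]
      rintro (h | h)
      exacts [huv h, G.loopless.irrefl u h.1]
  have hsub : (f '' C \ {f u, f v}).ncard ≤ 1 := by
    rw [Set.ncard_le_one (Set.toFinite _)]
    rintro _ ⟨⟨x, hx, rfl⟩, hx'⟩ _ ⟨⟨y, hy, rfl⟩, hy'⟩
    simp only [Set.mem_insert_iff, Set.mem_singleton_iff, not_or] at hx' hy'
    exact isAcyclic_common_neighbor_unique ha hf ⟨Ne.symm hx'.1, u, x, hx.1, rfl, rfl⟩
      ⟨Ne.symm hx'.2, v, x, hx.2, rfl, rfl⟩ ⟨Ne.symm hy'.1, u, y, hy.1, rfl, rfl⟩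
      ⟨Ne.symm hy'.2, v, y, hy.2, rfl, rfl⟩
  have h3 : (f '' insert u (insert v C)).ncard ≤ 3 := by
    have h4 : f '' insert u (insert v C) = (f '' C \ {f u, f v}) ∪ {f u, f v} := by
      rw [Set.image_insert_eq, Set.image_insert_eq, Set.sdiff_union_self]
      ext z; simp only [Set.mem_insert_iff, Set.mem_union, Set.mem_singleton_iff]; tauto
    rw [h4]
    have := Set.ncard_union_le (f '' C \ {f u, f v}) {f u, f v}
    have := Set.ncard_insert_le (f u) {f v}
    rw [Set.ncard_singleton] at this
    omega
  have := card_le_card_image_add hc (insert u (insert v C))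
  omega

theorem forest_identify_iff {V : Type} [Finite V] (G : SimpleGraph V) (k : ℕ) {u v : V}
    (huv : u ≠ v) (hk : k + 1 < (G.commonNeighbors u v).ncard) :
    Identifiable Forest k V G ↔ ∃ k' : ℕ, k = k' + 1 ∧
      Identifiable Forest k' {x : V // x ≠ v} (identify G u v) := by
  constructor
  · intro h
    rw [forest_iff] at h
    obtain ⟨W, f, hc, ha⟩ := h
    have hf := eq_of_common_neighbors hc ha huv hk
    have hr : Set.range (fun x : {x : V // x ≠ v} => f x) = Set.range f := by
      ext w
      constructor
      · rintro ⟨x, rfl⟩; exact ⟨x, rfl⟩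
      · rintro ⟨x, rfl⟩
        by_cases hx : x = v
        · exact ⟨⟨u, huv⟩, by rw [hx, ← hf]⟩
        · exact ⟨⟨x, hx⟩, rfl⟩
    have h1 := card_subtype_ne v
    have h2 : Nat.card (Set.range f) ≤ Nat.card {x : V // x ≠ v} := by
      rw [← hr]
      exact Nat.card_le_card_of_surjective _ Set.rangeFactorization_surjective
    refine ⟨k - 1, by omega, ?_⟩
    rw [forest_iff]
    refine ⟨W, fun x => f x, ?_, ?_⟩
    · rw [hr]; omega
    · rwa [map_identify G huv hf]
  · rintro ⟨k', rfl, h⟩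
    exact Or.inr ⟨u, v, huv, h⟩

/-! ### The size of reduced yes-instances -/

/-- In a graph without bridges with an acyclic quotient, a vertex that is not isolated and alone in
its class has two neighbours in one class: an edge to a neighbour `y` lies on a cycle, and the
image of the cycle in the forest uses the image of the edge twice. -/
theorem exists_adj_adj_of_no_bridge {V W : Type} {G : SimpleGraph V} {f : V → W}
    (hb : ∀ e ∈ G.edgeSet, ¬ G.IsBridge e) (ha : (G.map f).IsAcyclic) {w : V}
    (hw : ∀ x, f x = f w → x = w) (hi : ¬ G.IsIsolated w) :
    ∃ y z, y ≠ z ∧ f y = f z ∧ G.Adj w y ∧ G.Adj w z := by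
  simp only [SimpleGraph.IsIsolated, not_forall, not_not] at hi
  obtain ⟨y, hy⟩ := hi
  by_contra hno
  push Not at hno
  have hbr := hb s(w, y) hy
  rw [SimpleGraph.isBridge_iff, not_not] at hbr
  have hfwy : f w ≠ f y := fun h => hy.ne (hw y h.symm).symm
  have h1 := (SimpleGraph.isAcyclic_iff_forall_adj_isBridge.1 ha)
    (show (G.map f).Adj (f w) (f y) from ⟨hfwy, w, y, hy, rfl, rfl⟩)
  rw [SimpleGraph.isBridge_iff] at h1
  refine h1 (reachable_induct
    (P := fun p => ((G.map f).deleteEdges {s(f w, f y)}).Reachable (f w) (f p)) hbr .rfl ?_)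
  intro p q hpq hp
  rw [SimpleGraph.deleteEdges_adj] at hpq
  by_cases hfe : f p = f q
  · rwa [← hfe]
  refine hp.trans (SimpleGraph.Adj.reachable ?_)
  rw [SimpleGraph.deleteEdges_adj]
  refine ⟨⟨hfe, p, q, hpq.1, rfl, rfl⟩, fun he => hpq.2 ?_⟩
  rw [Set.mem_singleton_iff, Sym2.eq_iff] at he ⊢
  have key : ∀ r, f r = f y → G.Adj w r → r = y := fun r hr hadj => by
    by_contra hne
    exact hno y r (Ne.symm hne) hr.symm hy hadj
  rcases he with ⟨h2, h3⟩ | ⟨h2, h3⟩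
  · have := hw p h2
    subst this
    exact Or.inl ⟨rfl, key q h3 hpq.1⟩
  · have := hw q h3
    subst this
    exact Or.inr ⟨key p h2 hpq.1.symm, rfl⟩

/-- A partition that saves at most `k` vertices has at most `2 k` vertices in nontrivial classes. -/
theorem card_nontrivial_class_le {V W : Type} [Finite V] {f : V → W} {k : ℕ}
    (hc : Nat.card V ≤ Nat.card (Set.range f) + k) :
    {x : V | ∃ y, y ≠ x ∧ f y = f x}.ncard ≤ 2 * k := by
  classical
  have := Fintype.ofFinite V
  set X := {x : V | ∃ y, y ≠ x ∧ f y = f x} with hX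
  have h1 := card_le_card_image_add hc X
  have h2 : 2 * (f '' X).ncard ≤ X.ncard := by
    rw [Set.ncard_eq_toFinset_card' X, Set.ncard_eq_toFinset_card' (f '' X)]
    rw [mul_comm, Finset.card_eq_sum_card_fiberwise (f := f) (t := (f '' X).toFinset)]
    · rw [← smul_eq_mul, ← Finset.sum_const]
      refine Finset.sum_le_sum fun w hw => ?_
      rw [Set.mem_toFinset] at hw
      obtain ⟨x, ⟨y, hne, hy⟩, rfl⟩ := hw
      have : ({x, y} : Finset V) ⊆ X.toFinset.filter fun a => f a = f x := by
        intro a ha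
        rw [Finset.mem_insert, Finset.mem_singleton] at ha
        rw [Finset.mem_filter, Set.mem_toFinset]
        rcases ha with rfl | rfl
        · exact ⟨⟨y, hne, hy⟩, rfl⟩
        · exact ⟨⟨x, hne.symm, hy.symm⟩, hy⟩
      have h3 := Finset.card_le_card this
      rwa [Finset.card_pair hne.symm] at h3
    · intro x hx
      simp only [Set.coe_toFinset] at hx ⊢
      exact ⟨x, hx, rfl⟩
  omega

/-- Each vertex that is neither isolated nor in a nontrivial class is a common neighbour of one of
the pairs of vertices in nontrivial classes. -/
theorem card_nonisolated_le {V : Type} [Finite V] (G : SimpleGraph V) (k : ℕ)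
    (hb : ∀ e ∈ G.edgeSet, ¬ G.IsBridge e)
    (hcn : ∀ u v, u ≠ v → (G.commonNeighbors u v).ncard ≤ k + 1)
    (hyes : Identifiable Forest k V G) :
    {v | ¬ G.IsIsolated v}.ncard ≤ 2 * k + (k + 1) * (2 * k).choose 2 := by
  classical
  have := Fintype.ofFinite V
  rw [forest_iff] at hyes
  obtain ⟨W, f, hc, ha⟩ := hyes
  set X := {x : V | ∃ y, y ≠ x ∧ f y = f x} with hX
  have hX2 : X.ncard ≤ 2 * k := card_nontrivial_class_le hc
  have hsub : {v | ¬ G.IsIsolated v} ⊆ X ∪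
      ⋃ p ∈ X.toFinset.powersetCard 2, {w | ∀ y ∈ p, G.Adj w y} := by
    intro w hw
    by_cases hwX : w ∈ X
    · exact Or.inl hwX
    · refine Or.inr ?_
      have hw' : ∀ x, f x = f w → x = w := fun x hx => by
        by_contra hne; exact hwX ⟨x, hne, hx⟩
      obtain ⟨y, z, hyz, hf, hy, hz⟩ := exists_adj_adj_of_no_bridge hb ha hw' hw
      simp only [Set.mem_iUnion]
      refine ⟨{y, z}, ?_, ?_⟩
      · rw [Finset.mem_powersetCard, Finset.card_pair hyz]
        refine ⟨?_, rfl⟩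
        intro a ha
        rw [Finset.mem_insert, Finset.mem_singleton] at ha
        rw [Set.mem_toFinset]
        rcases ha with rfl | rfl
        · exact ⟨z, hyz.symm, hf.symm⟩
        · exact ⟨y, hyz, hf⟩
      · intro a ha
        rw [Finset.mem_insert, Finset.mem_singleton] at ha
        rcases ha with rfl | rfl
        exacts [hy, hz]
  refine (Set.ncard_le_ncard hsub (Set.toFinite _)).trans
    ((Set.ncard_union_le _ _).trans (add_le_add hX2 ?_))
  refine (Finset.set_ncard_biUnion_le _ _).trans ?_
  have h1 : ∀ p ∈ X.toFinset.powersetCard 2, {w | ∀ y ∈ p, G.Adj w y}.ncard ≤ k + 1 := by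
    intro p hp
    rw [Finset.mem_powersetCard, Finset.card_eq_two] at hp
    obtain ⟨-, u, v, huv, rfl⟩ := hp
    refine le_trans (Set.ncard_le_ncard ?_ (Set.toFinite _)) (hcn u v huv)
    intro w hw
    exact ⟨(hw u (by simp)).symm, (hw v (by simp)).symm⟩
  refine (Finset.sum_le_card_nsmul _ _ _ h1).trans ?_
  rw [Finset.card_powersetCard, smul_eq_mul, mul_comm, ← Set.ncard_eq_toFinset_card' X]
  exact Nat.mul_le_mul_left _ (Nat.choose_le_choose 2 hX2)

/-! ### From trees to forests -/

theorem reachable_map {V W : Type} {G : SimpleGraph V} (f : V → W) {x y : V}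
    (h : G.Reachable x y) : (G.map f).Reachable (f x) (f y) := by
  refine reachable_induct (P := fun z => (G.map f).Reachable (f x) (f z)) h .rfl ?_
  intro a b hab ha
  by_cases he : f a = f b
  · rwa [← he]
  · exact ha.trans (SimpleGraph.Adj.reachable ⟨he, a, b, hab, rfl, rfl⟩)

theorem connected_map {V W : Type} {G : SimpleGraph V} {f : V → W} (hf : Function.Surjective f)
    (h : G.Connected) : (G.map f).Connected := by
  have := h.nonempty.map f
  refine ⟨fun a b => ?_⟩
  obtain ⟨x, rfl⟩ := hf a
  obtain ⟨y, rfl⟩ := hf b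
  exact reachable_map f (h.preconnected x y)

theorem card_edgeSet_map_le {V W : Type} [Finite V] {G : SimpleGraph V} {f : V → W}
    {s : Set (Sym2 V)} (hs : ∀ x y, G.Adj x y → f x ≠ f y → s(x, y) ∈ s) :
    (G.map f).edgeSet.ncard ≤ s.ncard := by
  refine (Set.ncard_le_ncard (t := Sym2.map f '' s) ?_ (Set.toFinite _)).trans
    (Set.ncard_image_le (Set.toFinite _))
  intro e
  induction e with
  | _ a b =>
    rintro ⟨hne, x, y, hxy, rfl, rfl⟩
    exact ⟨s(x, y), hs x y hxy hne, rfl⟩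

/-- A forest has at most as many edges as it has vertices in excess of components: extend it to a
tree, and contract its components; the remaining edges connect them. -/
theorem card_edgeSet_add_card_connectedComponent_le {W : Type} [Finite W] [Nonempty W]
    {F : SimpleGraph W} (hF : F.IsAcyclic) :
    F.edgeSet.ncard + Nat.card F.ConnectedComponent ≤ Nat.card W := by
  obtain ⟨T, hFT, -, hT⟩ :=
    (SimpleGraph.connected_top (V := W)).exists_isTree_le_of_le_of_isAcyclic le_top hF
  have hTc := (SimpleGraph.isTree_iff_connected_and_card.1 hT).2
  have hQ : (T.map F.connectedComponentMk).Connected :=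
    connected_map Quot.mk_surjective hT.connected
  have h1 := hQ.card_vert_le_card_edgeSet_add_one
  have h2 := card_edgeSet_map_le (G := T) (f := F.connectedComponentMk)
    (s := T.edgeSet \ F.edgeSet) fun x y hxy hne =>
      ⟨hxy, fun h => hne (SimpleGraph.ConnectedComponent.connectedComponentMk_eq_of_adj h)⟩
  have h3 := Set.ncard_sdiff_add_ncard_of_subset (SimpleGraph.edgeSet_mono hFT) (Set.toFinite _)
  rw [Nat.card_coe_set_eq] at hTc h1
  omega

/-- The number of components of a quotient is at most that of the graph. -/
theorem card_connectedComponent_map_le {V W : Type} [Finite V] {G : SimpleGraph V} {f : V → W}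
    (hf : Function.Surjective f) :
    Nat.card (G.map f).ConnectedComponent ≤ Nat.card G.ConnectedComponent := by
  refine Nat.card_le_card_of_surjective
    (SimpleGraph.ConnectedComponent.lift (fun x => (G.map f).connectedComponentMk (f x)) ?_) ?_
  · intro x y p _
    exact SimpleGraph.ConnectedComponent.sound (reachable_map f p.reachable)
  · intro c
    induction c using SimpleGraph.ConnectedComponent.ind with
    | _ w =>
      obtain ⟨x, rfl⟩ := hf w
      exact ⟨G.connectedComponentMk x, rfl⟩

/-- To turn a forest into a tree, identify one vertex from each component. -/
theorem exists_isTree_map {W : Type} [Finite W] [Nonempty W] {F : SimpleGraph W}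
    (hF : F.IsAcyclic) : ∃ (X : Type) (g : W → X), Function.Surjective g ∧
      Nat.card W + 1 ≤ Nat.card X + Nat.card F.ConnectedComponent ∧ (F.map g).IsTree := by
  classical
  let r : F.ConnectedComponent → W := fun c => c.exists_rep.choose
  have hr : ∀ c, F.connectedComponentMk (r c) = c := fun c => c.exists_rep.choose_spec
  have hri : Function.Injective r := fun c d h => by rw [← hr c, ← hr d, h]
  obtain ⟨w⟩ := ‹Nonempty W›
  set w0 := r (F.connectedComponentMk w) with hw0
  let g0 : W → W := fun x => if x ∈ Set.range r then w0 else x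
  have hg : ∀ c, g0 (r c) = w0 := fun c => if_pos ⟨c, rfl⟩
  have hcard : (Set.range g0).ncard + Nat.card F.ConnectedComponent = Nat.card W + 1 := by
    have h1 : Set.range g0 = insert w0 (Set.range r)ᶜ := by
      ext x
      constructor
      · rintro ⟨y, rfl⟩
        by_cases hy : y ∈ Set.range r
        · exact Or.inl (if_pos hy)
        · refine Or.inr ?_
          rwa [show g0 y = y from if_neg hy]
      · rintro (rfl | hx)
        · exact ⟨w0, hg _⟩
        · exact ⟨x, if_neg hx⟩
    have h2 := Set.ncard_add_ncard_compl (Set.range r)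
    have h3 : (Set.range r).ncard = Nat.card F.ConnectedComponent := by
      rw [← Nat.card_coe_set_eq]
      exact Nat.card_range_of_injective hri
    rw [h1, Set.ncard_insert_of_notMem (fun h : w0 ∈ (Set.range r)ᶜ => h ⟨_, rfl⟩) (Set.toFinite _)]
    omega
  let g := Set.rangeFactorization g0
  have hX := Nat.card_coe_set_eq (Set.range g0)
  refine ⟨Set.range g0, g, Set.rangeFactorization_surjective, by omega, ?_⟩
  have hconn : (F.map g).Connected := by
    have : Nonempty (Set.range g0) := ⟨g w⟩
    have h1 : ∀ y, (F.map g).Reachable (g w0) (g y) := fun y => by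
      have h2 : F.Reachable (r (F.connectedComponentMk y)) y :=
        SimpleGraph.ConnectedComponent.exact (hr _)
      have h3 : g (r (F.connectedComponentMk y)) = g w0 :=
        Subtype.ext ((hg _).trans (hg _).symm)
      rw [← h3]
      exact reachable_map g h2
    refine ⟨fun a b => ?_⟩
    obtain ⟨x, rfl⟩ := Set.rangeFactorization_surjective a
    obtain ⟨y, rfl⟩ := Set.rangeFactorization_surjective b
    exact (h1 x).symm.trans (h1 y)
  rw [SimpleGraph.isTree_iff_connected_and_card]
  refine ⟨hconn, le_antisymm ?_ hconn.card_vert_le_card_edgeSet_add_one⟩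
  have : Nonempty W := ⟨w⟩
  have h4 := card_edgeSet_add_card_connectedComponent_le hF
  have h5 := card_edgeSet_map_le (G := F) (f := g) (s := F.edgeSet) fun x y h _ => h
  rw [Nat.card_coe_set_eq]
  omega

/-- If a quotient of a graph is connected, then splitting its classes along the `c` components
yields at least `c - 1` further classes: the bipartite incidence graph between classes and
components is connected, and its edges are the classes after the splitting. -/
theorem card_add_card_connectedComponent_le {V W : Type} [Finite V] {G : SimpleGraph V}
    {f : V → W} (hf : Function.Surjective f) (hc : (G.map f).Connected) :
    Nat.card W + Nat.card G.ConnectedComponent ≤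
      (Set.range fun x => (f x, G.connectedComponentMk x)).ncard + 1 := by
  have hW : Finite W := Finite.of_surjective f hf
  let B : SimpleGraph (W ⊕ G.ConnectedComponent) := SimpleGraph.fromEdgeSet
    (Set.range fun x => s(Sum.inl (f x), Sum.inr (G.connectedComponentMk x)))
  have hB : ∀ x, B.Adj (Sum.inl (f x)) (Sum.inr (G.connectedComponentMk x)) := fun x => by
    rw [SimpleGraph.fromEdgeSet_adj]
    exact ⟨⟨x, rfl⟩, Sum.inl_ne_inr⟩
  have hconn : B.Connected := by
    obtain ⟨w0⟩ := hc.nonempty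
    have h1 : ∀ w, B.Reachable (Sum.inl w0) (Sum.inl w) := fun w => by
      refine reachable_induct (P := fun w => B.Reachable (Sum.inl w0) (Sum.inl w))
        (hc.preconnected w0 w) .rfl ?_
      rintro _ _ ⟨-, x, y, hxy, rfl, rfl⟩ h
      refine h.trans ((hB x).reachable.trans ?_)
      rw [SimpleGraph.ConnectedComponent.connectedComponentMk_eq_of_adj hxy]
      exact (hB y).symm.reachable
    rw [SimpleGraph.connected_iff_exists_forall_reachable]
    refine ⟨Sum.inl w0, ?_⟩
    rintro (w | c)
    · exact h1 w
    · induction c using SimpleGraph.ConnectedComponent.ind with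
      | _ x => exact (h1 (f x)).trans (hB x).reachable
  have h2 := hconn.card_vert_le_card_edgeSet_add_one
  rw [Nat.card_sum, Nat.card_coe_set_eq] at h2
  refine h2.trans (Nat.add_le_add_right ?_ 1)
  let φ : W × G.ConnectedComponent → Sym2 (W ⊕ G.ConnectedComponent) :=
    fun p => s(Sum.inl p.1, Sum.inr p.2)
  refine (Set.ncard_le_ncard (t := φ '' Set.range fun x => (f x, G.connectedComponentMk x))
    ?_ (Set.toFinite _)).trans (Set.ncard_image_le (Set.toFinite _))
  rw [← Set.range_comp, SimpleGraph.edgeSet_fromEdgeSet]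
  exact Set.sdiff_subset

/-- A graph with `c` components can be turned into a tree by `k` identifications if and only if
`c - 1` of them are not needed for turning it into a forest. -/
theorem tree_iff_forest {V : Type} [Finite V] (G : SimpleGraph V) (k : ℕ) :
    Identifiable Tree k V G ↔ Nonempty V ∧ Nat.card G.ConnectedComponent ≤ k + 1 ∧
      Identifiable Forest (k + 1 - Nat.card G.ConnectedComponent) V G := by
  rw [tree_iff, forest_iff]
  constructor
  · rintro ⟨W, f, hf, hc, ht⟩
    have h1 := card_add_card_connectedComponent_le hf ht.connected
    set g := fun x => (f x, G.connectedComponentMk x)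
    have h2 : (Set.range g).ncard ≤ Nat.card V := by
      rw [← Nat.card_coe_set_eq]
      exact Nat.card_le_card_of_surjective _ Set.rangeFactorization_surjective
    refine ⟨?_, by omega, _, g, ?_, ?_⟩
    · obtain ⟨w⟩ := ht.connected.nonempty
      obtain ⟨x, -⟩ := hf w
      exact ⟨x⟩
    · rw [Nat.card_coe_set_eq]
      omega
    · exact isAcyclic_map_prod _
        (fun x y h => SimpleGraph.ConnectedComponent.connectedComponentMk_eq_of_adj h)
        ht.isAcyclic
  · rintro ⟨hne, hck, hF⟩
    rw [← forest_iff, identifiable_iff (H := Forest) fun e h => e.isAcyclic_iff.1 h] at hF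
    obtain ⟨W, f, hf, hc, ha⟩ := hF
    have := hne.map f
    have : Finite W := Finite.of_surjective f hf
    obtain ⟨X, g, hg, hX, ht⟩ := exists_isTree_map ha
    have h1 := card_connectedComponent_map_le (G := G) hf
    refine ⟨X, g ∘ f, hg.comp hf, by omega, ?_⟩
    rwa [← map_map_fun]

theorem tree_iff_forest_of_connected {V : Type} [Finite V] {G : SimpleGraph V} (k : ℕ)
    (h : G.Connected) : Identifiable Tree k V G ↔ Identifiable Forest k V G := by
  have h1 : Nat.card G.ConnectedComponent = 1 := by
    rw [Nat.card_eq_one_iff_unique]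
    obtain ⟨v⟩ := h.nonempty
    exact ⟨h.preconnected.subsingleton_connectedComponent, ⟨G.connectedComponentMk v⟩⟩
  rw [tree_iff_forest, h1, Nat.add_sub_cancel]
  exact ⟨fun h => h.2.2, fun h2 => ⟨h.nonempty, by omega, h2⟩⟩

/-! ### Identification without relabelling -/

/-- The identification of `u` and `v` on the same vertex set: `v` becomes an isolated vertex. -/
def merge {V : Type} (G : SimpleGraph V) (u v : V) : SimpleGraph V where
  Adj a b := a ≠ b ∧ a ≠ v ∧ b ≠ v ∧ (G.Adj a b ∨ (a = u ∧ G.Adj v b) ∨ (b = u ∧ G.Adj a v))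
  symm := ⟨by
    rintro a b ⟨h1, h2, h3, h | ⟨h, h'⟩ | ⟨h, h'⟩⟩
    · exact ⟨h1.symm, h3, h2, Or.inl h.symm⟩
    · exact ⟨h1.symm, h3, h2, Or.inr (Or.inr ⟨h, h'.symm⟩)⟩
    · exact ⟨h1.symm, h3, h2, Or.inr (Or.inl ⟨h, h'.symm⟩)⟩⟩
  loopless := ⟨fun _ h => h.1 rfl⟩

theorem induce_merge {V : Type} (G : SimpleGraph V) (u v : V) :
    (merge G u v).induce {x | x ≠ v} = identify G u v := by
  ext ⟨x, hx⟩ ⟨y, hy⟩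
  simp only [SimpleGraph.comap_adj, Function.Embedding.subtype_apply, merge, identify]
  have : x ≠ v := hx
  have : y ≠ v := hy
  simp only [ne_eq, Subtype.mk.injEq]
  tauto

theorem forest_merge_iff {V : Type} [Finite V] (G : SimpleGraph V) (k : ℕ) {u v : V} :
    Identifiable Forest k V (merge G u v) ↔
      Identifiable Forest k {x : V // x ≠ v} (identify G u v) := by
  rw [← induce_merge]
  refine forest_induce_iff _ k {x | x ≠ v} fun w hw z hz => ?_
  exact hw hz.2.1

theorem forest_iso_iff {V W : Type} [Finite V] [Finite W] {G : SimpleGraph V} {G' : SimpleGraph W}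
    (e : G ≃g G') (k : ℕ) : Identifiable Forest k V G ↔ Identifiable Forest k W G' := by
  have key : ∀ {V W : Type} [Finite V] [Finite W] {G : SimpleGraph V} {G' : SimpleGraph W}
      (_ : G ≃g G'), Identifiable Forest k V G → Identifiable Forest k W G' := by
    intro V W _ _ G G' e h
    rw [forest_iff] at h ⊢
    obtain ⟨X, f, hc, ha⟩ := h
    refine ⟨X, f ∘ e.symm, ?_, ?_⟩
    · rw [e.symm.surjective.range_comp, ← Nat.card_congr e.toEquiv]
      exact hc
    · refine ha.anti ?_
      rintro a b ⟨hne, x, y, hxy, rfl, rfl⟩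
      exact ⟨hne, e.symm x, e.symm y, e.symm.map_rel_iff.2 hxy, rfl, rfl⟩
  exact ⟨key e, key e.symm⟩

/-! ### Loop programs -/

/-- Programs whose only loops are `loop x P`: the body `P` is run for `x = 0, …, n - 1`, where `n`
is the value of variable `0`. -/
inductive LoopProg where
  | skip
  | assign (x : ℕ) (e : Expr)
  | put (a : ℕ) (i e : Expr)
  | seq (P Q : LoopProg)
  | ite (e : Expr) (P Q : LoopProg)
  | loop (x : ℕ) (P : LoopProg)

namespace LoopProg

/-- The store after `i` rounds of a loop with counter `x`, whose body acts as `f`. -/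
def rounds (f : Store → Store) (x : ℕ) (s : Store) : ℕ → Store
  | 0 => s.setVar x 0
  | i + 1 => (f (rounds f x s i)).setVar x (i + 1)

/-- The store in which a loop program halts. -/
def run : LoopProg → Store → Store
  | skip, s => s
  | assign x e, s => s.setVar x (e.eval s)
  | put a i e, s => s.setArr a (i.eval s) (e.eval s)
  | seq P Q, s => Q.run (P.run s)
  | ite e P Q, s => if e.eval s ≠ 0 then P.run s else Q.run s
  | loop x P, s => rounds P.run x s (s.var 0)

/-- The variables that a loop program may write. -/
def vars : LoopProg → List ℕ
  | skip => []
  | assign x _ => [x]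
  | put _ _ _ => []
  | seq P Q => P.vars ++ Q.vars
  | ite _ P Q => P.vars ++ Q.vars
  | loop x P => x :: P.vars

/-- The arrays that a loop program may write. -/
def arrs : LoopProg → List ℕ
  | skip => []
  | assign _ _ => []
  | put a _ _ => [a]
  | seq P Q => P.arrs ++ Q.arrs
  | ite _ P Q => P.arrs ++ Q.arrs
  | loop _ P => P.arrs

/-- No loop body writes its counter or the bound of the loops. -/
def WF : LoopProg → Prop
  | skip => True
  | assign _ _ => True
  | put _ _ _ => True
  | seq P Q => P.WF ∧ Q.WF
  | ite _ P Q => P.WF ∧ Q.WF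
  | loop x P => x ≠ 0 ∧ x ∉ P.vars ∧ 0 ∉ P.vars ∧ P.WF

instance decidableWF : ∀ P : LoopProg, Decidable P.WF
  | skip => inferInstanceAs (Decidable True)
  | assign _ _ => inferInstanceAs (Decidable True)
  | put _ _ _ => inferInstanceAs (Decidable True)
  | seq P Q => @instDecidableAnd _ _ (decidableWF P) (decidableWF Q)
  | ite _ P Q => @instDecidableAnd _ _ (decidableWF P) (decidableWF Q)
  | loop x P =>
    have := decidableWF P
    inferInstanceAs (Decidable (x ≠ 0 ∧ x ∉ P.vars ∧ 0 ∉ P.vars ∧ P.WF))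

/-- The translation into a program of the random access machine. -/
def compile : LoopProg → Prog
  | skip => .skip
  | assign x e => .assign x e
  | put a i e => .put a i e
  | seq P Q => .seq P.compile Q.compile
  | ite e P Q => .ite e P.compile Q.compile
  | loop x P => .seq (.assign x (.const 0)) (.while (.sub (.var 0) (.var x))
      (.seq P.compile (.assign x (.add (.var x) (.const 1)))))

/-- A bound on the number of steps, as a polynomial in the value of variable `0`. -/
noncomputable def cost : LoopProg → Polynomial ℕ
  | skip => 1
  | assign _ e => .C (e.cost + 1)
  | put _ i e => .C (i.cost + e.cost + 1)
  | seq P Q => P.cost + Q.cost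
  | ite e P Q => .C (e.cost + 1) + P.cost + Q.cost
  | loop _ P => 6 + .X * (8 + P.cost)

end LoopProg

@[simp] theorem Store.setVar_var (s : Store) (x c y : ℕ) :
    (s.setVar x c).var y = if y = x then c else s.var y := by
  simp [Store.setVar, Function.update_apply]

@[simp] theorem Store.setVar_arr (s : Store) (x c : ℕ) : (s.setVar x c).arr = s.arr := rfl

@[simp] theorem Store.setArr_var (s : Store) (a i c : ℕ) : (s.setArr a i c).var = s.var := rfl

@[simp] theorem Store.setArr_arr (s : Store) (a i c b j : ℕ) :
    (s.setArr a i c).arr b j = if b = a ∧ j = i then c else s.arr b j := by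
  simp only [Store.setArr, Function.update_apply]
  split_ifs <;> simp_all

theorem Store.setArr_arr_of_ne (s : Store) {a b : ℕ} (h : b ≠ a) (i c : ℕ) :
    (s.setArr a i c).arr b = s.arr b := by
  simp [Store.setArr, h]

namespace LoopProg

/-- A program changes only the variables and the arrays that it writes. -/
theorem run_frame (P : LoopProg) (s : Store) :
    (∀ x ∉ P.vars, (P.run s).var x = s.var x) ∧ (∀ a ∉ P.arrs, (P.run s).arr a = s.arr a) := by
  induction P generalizing s with
  | skip => exact ⟨fun _ _ => rfl, fun _ _ => rfl⟩
  | assign x e =>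
    refine ⟨fun y hy => ?_, fun _ _ => rfl⟩
    simp only [vars, List.mem_singleton] at hy
    simp [run, hy]
  | put a i e =>
    refine ⟨fun _ _ => rfl, fun b hb => ?_⟩
    simp only [arrs, List.mem_singleton] at hb
    exact Store.setArr_arr_of_ne _ hb _ _
  | seq P Q ihP ihQ =>
    simp only [vars, arrs, List.mem_append, not_or, run]
    exact ⟨fun x hx => ((ihQ _).1 x hx.2).trans ((ihP _).1 x hx.1),
      fun a ha => ((ihQ _).2 a ha.2).trans ((ihP _).2 a ha.1)⟩
  | ite e P Q ihP ihQ =>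
    simp only [vars, arrs, List.mem_append, not_or, run]
    split_ifs
    · exact ⟨fun x hx => (ihP _).1 x hx.1, fun a ha => (ihP _).2 a ha.1⟩
    · exact ⟨fun x hx => (ihQ _).1 x hx.2, fun a ha => (ihQ _).2 a ha.2⟩
  | loop x P ih =>
    simp only [vars, arrs, List.mem_cons, not_or, run]
    generalize s.var 0 = n
    induction n with
    | zero => exact ⟨fun y hy => by simp [rounds, hy.1], fun _ _ => rfl⟩
    | succ n ihn =>
      refine ⟨fun y hy => ?_, fun a ha => ?_⟩
      · simp only [rounds, Store.setVar_var, if_neg hy.1]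
        exact ((ih _).1 y hy.2).trans (ihn.1 y hy)
      · exact ((ih _).2 a ha).trans (ihn.2 a ha)

theorem rounds_var (P : LoopProg) (x : ℕ) (s : Store) : ∀ i, (rounds P.run x s i).var x = i
  | 0 => by simp [rounds]
  | i + 1 => by simp [rounds]

theorem rounds_frame (P : LoopProg) (x : ℕ) (s : Store) (i : ℕ) :
    (∀ y ∉ (loop x P).vars, (rounds P.run x s i).var y = s.var y) ∧
      (∀ a ∉ P.arrs, (rounds P.run x s i).arr a = s.arr a) := by
  simp only [vars, List.mem_cons, not_or]
  induction i with
  | zero => exact ⟨fun y hy => by simp [rounds, hy.1], fun _ _ => rfl⟩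
  | succ i ih =>
    refine ⟨fun y hy => ?_, fun a ha => ?_⟩
    · simp only [rounds, Store.setVar_var, if_neg hy.1]
      exact ((run_frame P _).1 y hy.2).trans (ih.1 y hy)
    · exact ((run_frame P _).2 a ha).trans (ih.2 a ha)

/-- A loop program halts, in the store that `run` describes, and the number of its steps is
polynomial in variable `0`, provided that it never writes this variable. -/
theorem exec_compile (P : LoopProg) (hP : P.WF) (s : Store) :
    ∃ t, Exec P.compile s (P.run s) t ∧ (0 ∉ P.vars → t ≤ P.cost.eval (s.var 0)) := by
  induction P generalizing s with
  | skip => exact ⟨1, .skip s, fun _ => by simp [cost]⟩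
  | assign x e => exact ⟨_, .assign x e s, fun _ => by simp [cost]⟩
  | put a i e => exact ⟨_, .put a i e s, fun _ => by simp [cost]⟩
  | seq P Q ihP ihQ =>
    obtain ⟨t, h, ht⟩ := ihP hP.1 s
    obtain ⟨t', h', ht'⟩ := ihQ hP.2 (P.run s)
    refine ⟨_, .seq h h', fun h0 => ?_⟩
    simp only [vars, List.mem_append, not_or] at h0
    rw [(run_frame P s).1 0 h0.1] at ht'
    simp only [cost, Polynomial.eval_add]
    exact add_le_add (ht h0.1) (ht' h0.2)
  | ite e P Q ihP ihQ =>
    by_cases he : e.eval s = 0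
    · obtain ⟨t, h, ht⟩ := ihQ hP.2 s
      refine ⟨e.cost + 1 + t, ?_, fun h0 => ?_⟩
      · simp only [run, he, ne_eq, not_true_eq_false, if_false]
        exact .ite_false he h
      · simp only [vars, List.mem_append, not_or] at h0
        have := ht h0.2
        simp only [cost, Polynomial.eval_add, Polynomial.eval_C]
        omega
    · obtain ⟨t, h, ht⟩ := ihP hP.1 s
      refine ⟨e.cost + 1 + t, ?_, fun h0 => ?_⟩
      · simp only [run, he, ne_eq, not_false_eq_true, if_true]
        exact .ite_true he h
      · simp only [vars, List.mem_append, not_or] at h0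
        have := ht h0.1
        simp only [cost, Polynomial.eval_add, Polynomial.eval_C]
        omega
  | loop x P ih =>
    obtain ⟨hx0, hxP, h0P, hWF⟩ := hP
    set n := s.var 0 with hn
    have hx0' : (0 : ℕ) ∉ (loop x P).vars := by
      simp only [vars, List.mem_cons, not_or]
      exact ⟨hx0.symm, h0P⟩
    have key : ∀ m i, i + m = n → ∃ t, Exec (.while (.sub (.var 0) (.var x))
        (.seq P.compile (.assign x (.add (.var x) (.const 1))))) (rounds P.run x s i)
        (rounds P.run x s n) t ∧ t ≤ m * (8 + P.cost.eval n) + 4 := by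
      intro m
      induction m with
      | zero =>
        intro i hi
        rw [Nat.add_zero] at hi
        rw [hi]
        refine ⟨_, .while_false ?_, ?_⟩
        · have h0 := (rounds_frame P x s n).1 0 hx0'
          have h1 := rounds_var P x s n
          simp only [Expr.eval, h0, h1]
          omega
        · simp [Expr.cost]
      | succ m ihm =>
        intro i hi
        obtain ⟨t, h, ht⟩ := ih hWF (rounds P.run x s i)
        obtain ⟨t', h', ht'⟩ := ihm (i + 1) (by omega)
        have h0 := (rounds_frame P x s i).1 0 hx0'
        have h1 := rounds_var P x s i
        have ht := ht h0P
        rw [h0] at ht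
        have hlast : rounds P.run x s (i + 1) = (P.run (rounds P.run x s i)).setVar x
            ((Expr.add (.var x) (.const 1)).eval (P.run (rounds P.run x s i))) := by
          simp only [rounds, Expr.eval, (run_frame P _).1 x hxP, h1]
        rw [hlast] at h'
        refine ⟨_, .while_true ?_ (.seq h (.assign _ _ _)) h', ?_⟩
        · simp only [Expr.eval, h0, h1]
          omega
        · simp only [Expr.cost]
          rw [← hn] at ht
          rw [Nat.succ_mul]
          omega
    obtain ⟨t, h, ht⟩ := key n 0 (by omega)
    refine ⟨_, .seq (.assign _ _ _) h, fun _ => ?_⟩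
    simp only [cost, Expr.cost, Polynomial.eval_add, Polynomial.eval_mul, Polynomial.eval_X,
      Polynomial.eval_ofNat]
    omega

/-- The rule for loops: an invariant may use that the body is run with the counter `i`, in a store
that differs from the initial one only where the loop writes. -/
theorem run_loop {x : ℕ} {P : LoopProg} {s : Store} (I : ℕ → Store → Prop)
    (hI : ∀ i s' c, I i s' → I i (s'.setVar x c)) (h0 : I 0 s)
    (hstep : ∀ i < s.var 0, ∀ s' : Store, s'.var x = i →
      (∀ y ∉ (loop x P).vars, s'.var y = s.var y) → (∀ a ∉ P.arrs, s'.arr a = s.arr a) →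
      I i s' → I (i + 1) (P.run s')) :
    I (s.var 0) ((loop x P).run s) := by
  have : ∀ i ≤ s.var 0, I i (rounds P.run x s i) := by
    intro i
    induction i with
    | zero => exact fun _ => hI _ _ _ h0
    | succ i ih =>
      intro hi
      exact hI _ _ _ (hstep i (by omega) _ (rounds_var P x s i) (rounds_frame P x s i).1
        (rounds_frame P x s i).2 (ih (by omega)))
  exact this _ le_rfl

/-- The rule for two nested loops: the pairs are visited in lexicographic order, so that
`i * n + j` pairs come before `(i, j)`. -/
theorem run_loop_loop {x y : ℕ} {P : LoopProg} {s : Store} (I : ℕ → Store → Prop)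
    (hx : ∀ i s' c, I i s' → I i (s'.setVar x c)) (hy : ∀ i s' c, I i s' → I i (s'.setVar y c))
    (hxy : x ≠ y) (hxP : x ∉ P.vars) (h0P : 0 ∉ (loop x (loop y P)).vars) (h0 : I 0 s)
    (hstep : ∀ i < s.var 0, ∀ j < s.var 0, ∀ s' : Store, s'.var x = i → s'.var y = j →
      (∀ z ∉ (loop x (loop y P)).vars, s'.var z = s.var z) →
      (∀ a ∉ P.arrs, s'.arr a = s.arr a) →
      I (i * s.var 0 + j) s' → I (i * s.var 0 + j + 1) (P.run s')) :
    I (s.var 0 * s.var 0) ((loop x (loop y P)).run s) := by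
  refine run_loop (fun i => I (i * s.var 0)) (fun i s' c => hx _ _ _) (by simpa using h0) ?_
  intro i hi s' hs'x hs'v hs'a hs'
  have e0 := hs'v 0 h0P
  have h1 := run_loop (x := y) (P := P) (s := s') (fun j => I (i * s.var 0 + j))
    (fun j s' c => hy _ _ _) hs' (fun j hj s'' h1 h2 h3 h4 => by
      refine hstep i hi j (by omega) s'' ?_ h1 (fun z hz => ?_) (fun a ha => ?_) h4
      · rw [h2 x, hs'x]
        simp only [vars, List.mem_cons, not_or]
        exact ⟨hxy, hxP⟩
      · rw [h2 z, hs'v z hz]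
        intro h
        exact hz (List.mem_cons_of_mem _ h)
      · rw [h3 a ha, hs'a a ha])
  rw [e0] at h1
  rwa [Nat.succ_mul]

end LoopProg

open LoopProg

/-! ### Graphs in the memory -/

/-!
Array `0` holds the adjacency matrix and array `1` the indices at which its rows begin. Array `2`
marks the vertices reached by a search. For the output, array `3` is a copy of the matrix, array `4`
holds the new numbers of the vertices, and array `5` the indices at which the new rows begin.

Variable `0` holds the number of vertices and variable `1` the parameter. Variables `4` and `5` hold
the pair of vertices to which a rule is applied, variable `6` the start of a search, and variable
`12` the current vertex of other loops. Variable `14` is not `0` if the instance is known to be a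
no-instance, and variable `15` is the number of vertices of the output. -/

theorem addr_inj {n : ℕ} {a b c d : ℕ} (hb : b < n) (hd : d < n) :
    a * n + b = c * n + d ↔ a = c ∧ b = d := by
  refine ⟨fun h => ?_, by rintro ⟨rfl, rfl⟩; rfl⟩
  have hac : a = c := by
    have h1 : (a * n + b) / n = a := by
      rw [mul_comm, Nat.mul_add_div (by omega), Nat.div_eq_of_lt hb, Nat.add_zero]
    have h2 : (c * n + d) / n = c := by
      rw [mul_comm, Nat.mul_add_div (by omega), Nat.div_eq_of_lt hd, Nat.add_zero]
    rw [← h1, h, h2]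
  subst hac
  exact ⟨rfl, by omega⟩

theorem addr_lt {n a b : ℕ} (ha : a < n) (hb : b < n) : a * n + b < n * n := by
  have := Nat.mul_le_mul_right n (Nat.succ_le_of_lt ha)
  rw [Nat.succ_mul] at this
  omega

/-- In the lexicographic order of the pairs, exactly those before `(c, d)` and `(c, d)` itself come
before the successor of `(c, d)`. -/
theorem addr_lt_succ {n : ℕ} {a b c d : ℕ} (hb : b < n) (hd : d < n) :
    a * n + b < c * n + d + 1 ↔ a * n + b < c * n + d ∨ (a = c ∧ b = d) := by
  rw [Nat.lt_succ_iff_lt_or_eq, addr_inj hb hd]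

open Classical in
/-- The store `s` holds the graph `G`: variable `0` is the number of vertices, array `0` the
adjacency matrix, and array `1` contains the indices at which its rows begin. -/
structure Holds {n : ℕ} (s : Store) (G : SimpleGraph (Fin n)) : Prop where
  card : s.var 0 = n
  row : ∀ i < n, s.arr 1 i = i * n
  adj : ∀ i j : Fin n, s.arr 0 (i * n + j) = if G.Adj i j then 1 else 0

theorem Holds.of_eq {n : ℕ} {s s' : Store} {G : SimpleGraph (Fin n)} (h : Holds s G)
    (hv : s'.var 0 = s.var 0) (h0 : s'.arr 0 = s.arr 0) (h1 : s'.arr 1 = s.arr 1) :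
    Holds s' G := ⟨hv ▸ h.card, h1 ▸ h.row, h0 ▸ h.adj⟩

theorem Holds.frame {n : ℕ} {s : Store} {G : SimpleGraph (Fin n)} (h : Holds s G) (P : LoopProg)
    (hv : 0 ∉ P.vars) (h0 : 0 ∉ P.arrs) (h1 : 1 ∉ P.arrs) : Holds (P.run s) G :=
  h.of_eq ((run_frame P s).1 0 hv) ((run_frame P s).2 0 h0) ((run_frame P s).2 1 h1)

theorem Holds.setVar {n : ℕ} {s : Store} {G : SimpleGraph (Fin n)} (h : Holds s G) {x : ℕ}
    (hx : x ≠ 0) (c : ℕ) : Holds (s.setVar x c) G :=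
  h.of_eq (by simp [hx.symm]) rfl rfl

/-- The index of the matrix entry for the values of the variables `x` and `y`. -/
def addr (x y : ℕ) : Expr := .add (.get 1 (.var x)) (.var y)

/-- The matrix entry for the values of the variables `x` and `y`. -/
def entry (x y : ℕ) : Expr := .get 0 (addr x y)

theorem Holds.addr_eval {n : ℕ} {s : Store} {G : SimpleGraph (Fin n)} (h : Holds s G) {x y : ℕ}
    {i j : Fin n} (hx : s.var x = i) (hy : s.var y = j) : (addr x y).eval s = i * n + j := by
  simp [addr, Expr.eval, hx, hy, h.row i i.2]

theorem Holds.entry_ne_zero {n : ℕ} {s : Store} {G : SimpleGraph (Fin n)} (h : Holds s G)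
    {x y : ℕ} {i j : Fin n} (hx : s.var x = i) (hy : s.var y = j) :
    (entry x y).eval s ≠ 0 ↔ G.Adj i j := by
  rw [entry, Expr.eval, h.addr_eval hx hy, h.adj]
  split_ifs with h <;> simp [h]

/-- Set both matrix entries for the values of `x` and `y` to `c`. -/
def setEdge (x y c : ℕ) : LoopProg :=
  .seq (.put 0 (addr x y) (.const c)) (.put 0 (addr y x) (.const c))

theorem setEdge_arr {n : ℕ} {s : Store} {G : SimpleGraph (Fin n)} (h : Holds s G) {x y c : ℕ}
    {i j : Fin n} (hx : s.var x = i) (hy : s.var y = j) (a b : Fin n) :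
    ((setEdge x y c).run s).arr 0 (a * n + b) =
      if (a = i ∧ b = j) ∨ (a = j ∧ b = i) then c else s.arr 0 (a * n + b) := by
  have h1 := h.addr_eval hx hy
  have h2 : (addr y x).eval (s.setArr 0 ((addr x y).eval s) c) = j * n + i := by
    simp [addr, Expr.eval, hx, hy, h.row j j.2]
  simp only [setEdge, run, Expr.eval] at h2 ⊢
  rw [Store.setArr_arr, h2, Store.setArr_arr, h1]
  simp only [true_and, addr_inj b.2 i.2, addr_inj b.2 j.2, ← Fin.ext_iff]
  split_ifs <;> first | rfl | (exfalso; tauto)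

theorem Holds.deleteEdge {n : ℕ} {s : Store} {G : SimpleGraph (Fin n)} (h : Holds s G) {x y : ℕ}
    {i j : Fin n} (hx : s.var x = i) (hy : s.var y = j) :
    Holds ((setEdge x y 0).run s) (G.deleteEdges {s(i, j)}) := by
  refine ⟨?_, ?_, fun a b => ?_⟩
  · rw [(run_frame _ _).1 0 (by simp [setEdge, vars])]; exact h.card
  · rw [(run_frame _ _).2 1 (by simp [setEdge, arrs])]; exact h.row
  · rw [setEdge_arr h hx hy, h.adj]
    have e : (G.deleteEdges {s(i, j)}).Adj a b ↔
        G.Adj a b ∧ ¬(a = i ∧ b = j ∨ a = j ∧ b = i) := by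
      simp only [SimpleGraph.deleteEdges_adj, Set.mem_singleton_iff, Sym2.eq_iff]
    split_ifs <;> first | rfl | (exfalso; tauto)

theorem Holds.addEdge {n : ℕ} {s : Store} {G : SimpleGraph (Fin n)} (h : Holds s G) {x y : ℕ}
    {i j : Fin n} (hij : i ≠ j) (hx : s.var x = i) (hy : s.var y = j) :
    Holds ((setEdge x y 1).run s) (G ⊔ SimpleGraph.edge i j) := by
  refine ⟨?_, ?_, fun a b => ?_⟩
  · rw [(run_frame _ _).1 0 (by simp [setEdge, vars])]; exact h.card
  · rw [(run_frame _ _).2 1 (by simp [setEdge, arrs])]; exact h.row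
  · rw [setEdge_arr h hx hy, h.adj]
    have e : (G ⊔ SimpleGraph.edge i j).Adj a b ↔
        G.Adj a b ∨ (a = i ∧ b = j ∨ a = j ∧ b = i) ∧ a ≠ b := by
      simp only [SimpleGraph.sup_adj, SimpleGraph.edge_adj]
    have : (a = i ∧ b = j) ∨ (a = j ∧ b = i) → a ≠ b := by
      rintro (⟨rfl, rfl⟩ | ⟨rfl, rfl⟩)
      exacts [hij, hij.symm]
    split_ifs <;> first | rfl | (exfalso; tauto)

/-! ### Computing a component -/

/-- One round of the search: mark the neighbours of the marked vertices. -/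
def spreadProg : LoopProg :=
  .loop 8 (.loop 9 (.ite (.get 2 (.var 8))
    (.ite (entry 8 9) (.put 2 (.var 9) (.const 1)) .skip) .skip))

/-- Mark in array `2` the vertices that can be reached from the one in variable `6`. -/
def reachProg : LoopProg :=
  .seq (.loop 7 (.put 2 (.var 7) (.const 0)))
    (.seq (.put 2 (.var 6) (.const 1)) (.loop 7 spreadProg))

theorem spreadProg_spec {n : ℕ} {s : Store} {G : SimpleGraph (Fin n)} (h : Holds s G)
    {R : Fin n → Prop} (hR : ∀ a b, G.Adj a b → R a → R b)
    (hs : ∀ v : Fin n, s.arr 2 v ≠ 0 → R v) :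
    (∀ v : Fin n, (spreadProg.run s).arr 2 v ≠ 0 → R v) ∧
    (∀ v : Fin n, s.arr 2 v ≠ 0 → (spreadProg.run s).arr 2 v ≠ 0) ∧
    (∀ a b : Fin n, s.arr 2 a ≠ 0 → G.Adj a b → (spreadProg.run s).arr 2 b ≠ 0) := by
  have hn := h.card
  have key := run_loop_loop (x := 8) (y := 9) (s := s)
    (P := .ite (.get 2 (.var 8)) (.ite (entry 8 9) (.put 2 (.var 9) (.const 1)) .skip) .skip)
    (fun c s' => (∀ v : Fin n, s'.arr 2 v ≠ 0 → R v) ∧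
      (∀ v : Fin n, s.arr 2 v ≠ 0 → s'.arr 2 v ≠ 0) ∧
      (∀ a b : Fin n, (a : ℕ) * n + b < c → s.arr 2 a ≠ 0 → G.Adj a b → s'.arr 2 b ≠ 0))
    (fun _ _ _ h => h) (fun _ _ _ h => h) (by decide) (by decide) (by decide)
    ⟨hs, fun _ h => h, fun a b hab => by omega⟩ ?_
  · rw [hn] at key
    exact ⟨key.1, key.2.1, fun a b => key.2.2 a b (addr_lt a.2 b.2)⟩
  intro i hi j hj s' hx hy hv ha ⟨h1, h2, h3⟩
  rw [hn] at hi hj h3 ⊢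
  have hH : Holds s' G := h.of_eq (hv 0 (by decide)) (ha 0 (by decide)) (ha 1 (by decide))
  have he := hH.entry_ne_zero (x := 8) (y := 9) (i := ⟨i, hi⟩) (j := ⟨j, hj⟩) hx hy
  simp only [addr_lt_succ (Fin.is_lt _) hj]
  simp only [run]
  split_ifs with c1 c2
  · rw [he] at c2
    simp only [Expr.eval, hx, hy] at c1 ⊢
    refine ⟨fun v hv => ?_, fun v hv => ?_, fun a b hab ha hadj => ?_⟩
    · by_cases hvj : (v : ℕ) = j
      · have : v = ⟨j, hj⟩ := Fin.ext hvj
        rw [this]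
        exact hR _ _ c2 (h1 ⟨i, hi⟩ c1)
      · exact h1 v (by simpa [hvj] using hv)
    · simp only [Store.setArr_arr]
      split_ifs
      · simp
      · exact h2 v hv
    · simp only [Store.setArr_arr]
      split_ifs with h4
      · simp
      · rcases hab with hab | ⟨-, hab⟩
        · exact h3 a b hab ha hadj
        · exact (h4 ⟨trivial, hab⟩).elim
  · refine ⟨h1, h2, fun a b hab ha hadj => ?_⟩
    rcases hab with hab | ⟨rfl, rfl⟩
    · exact h3 a b hab ha hadj
    · exact (c2 (he.2 hadj)).elim
  · refine ⟨h1, h2, fun a b hab ha hadj => ?_⟩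
    rcases hab with hab | ⟨rfl, rfl⟩
    · exact h3 a b hab ha hadj
    · refine (c1 ?_).elim
      simp only [Expr.eval, hx]
      exact h2 a ha

theorem reachProg_spec {n : ℕ} {s : Store} {G : SimpleGraph (Fin n)} (h : Holds s G) {u : Fin n}
    (hu : s.var 6 = u) (v : Fin n) : (reachProg.run s).arr 2 v ≠ 0 ↔ G.Reachable u v := by
  have hn := h.card
  set s1 := (LoopProg.loop 7 (.put 2 (.var 7) (.const 0))).run s with hs1
  have h1 : ∀ v : Fin n, s1.arr 2 v = 0 := by
    have := run_loop (x := 7) (s := s) (P := .put 2 (.var 7) (.const 0))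
      (fun i s' => ∀ v < i, s'.arr 2 v = 0) (fun _ _ _ h => h) (fun v hv => by omega) ?_
    · rw [hn] at this
      exact fun v => this v v.2
    · intro i hi s' hx hv ha hI v hvi
      simp only [run, Expr.eval, hx, Store.setArr_arr]
      split_ifs with h4
      · rfl
      · exact hI v (by simp only [true_and] at h4; omega)
  set s2 := (LoopProg.put 2 (.var 6) (.const 1)).run s1 with hs2
  have hH : Holds s2 G := (h.frame _ (by decide) (by decide) (by decide)).frame _ (by decide)
    (by decide) (by decide)
  have h6 : s1.var 6 = u := by rw [hs1, (run_frame _ _).1 6 (by decide), hu]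
  have h2 : ∀ v : Fin n, s2.arr 2 v ≠ 0 ↔ v = u := by
    intro v
    simp [hs2, run, Expr.eval, h6, h1, Fin.ext_iff]
  have key := run_loop (x := 7) (s := s2) (P := spreadProg)
    (fun r s' => (∀ v : Fin n, s'.arr 2 v ≠ 0 → G.Reachable u v) ∧
      ∀ (v : Fin n) (p : G.Walk v u), p.length ≤ r → s'.arr 2 v ≠ 0)
    (fun _ _ _ h => h) ⟨fun v hv => by rw [(h2 v).1 hv], ?_⟩ ?_
  · rw [hH.card] at key
    refine ⟨key.1 v, fun hr => ?_⟩
    obtain ⟨p, hp⟩ := hr.symm.exists_isPath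
    refine key.2 v p ?_
    have := hp.length_lt
    rw [Fintype.card_fin] at this
    omega
  · intro v p hp
    rw [h2]
    exact SimpleGraph.Walk.eq_of_length_eq_zero (Nat.le_zero.1 hp)
  · intro r hr s' hx hv ha ⟨h3, h4⟩
    have hH' : Holds s' G := hH.of_eq (hv 0 (by decide)) (ha 0 (by decide)) (ha 1 (by decide))
    obtain ⟨k1, k2, k3⟩ := spreadProg_spec hH' (R := G.Reachable u)
      (fun a b hab ha => ha.trans hab.reachable) h3
    refine ⟨k1, fun v p hp => ?_⟩
    cases p with
    | nil => exact k2 _ (h4 _ .nil (Nat.zero_le _))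
    | cons hadj q =>
      rw [SimpleGraph.Walk.length_cons] at hp
      exact k3 _ _ (h4 _ q (by omega)) hadj.symm

/-! ### The reduction rules as programs -/

/-- The instance `(G', k')` of Forest-Identification is equivalent to `(G, k)`, and its parameter is
not larger. -/
def Safe {n : ℕ} (G : SimpleGraph (Fin n)) (k : ℕ) (G' : SimpleGraph (Fin n)) (k' : ℕ) : Prop :=
  k' ≤ k ∧ (Identifiable Forest k' (Fin n) G' ↔ Identifiable Forest k (Fin n) G)

theorem Safe.refl {n : ℕ} (G : SimpleGraph (Fin n)) (k : ℕ) : Safe G k G k := ⟨le_rfl, Iff.rfl⟩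

theorem Safe.trans {n : ℕ} {G G' G'' : SimpleGraph (Fin n)} {k k' k'' : ℕ} (h : Safe G k G' k')
    (h' : Safe G' k' G'' k'') : Safe G k G'' k'' := ⟨h'.1.trans h.1, h'.2.trans h.2⟩

/-- The edge `x y` can be deleted. -/
def IsBridgePair {n : ℕ} (G : SimpleGraph (Fin n)) (x y : Fin n) : Prop :=
  G.Adj x y ∧ G.IsBridge s(x, y)

/-- The vertices `x` and `y` can be identified, with a positive parameter. -/
def IsTwinPair {n : ℕ} (G : SimpleGraph (Fin n)) (k : ℕ) (x y : Fin n) : Prop :=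
  1 ≤ k ∧ x ≠ y ∧ k + 1 < (G.commonNeighbors x y).ncard

theorem IsBridgePair.safe {n : ℕ} {G : SimpleGraph (Fin n)} {x y : Fin n}
    (h : IsBridgePair G x y) (k : ℕ) : Safe G k (G.deleteEdges {s(x, y)}) k :=
  ⟨le_rfl, (forest_deleteEdges_iff G k h.1 h.2).symm⟩

theorem IsTwinPair.safe {n : ℕ} {G : SimpleGraph (Fin n)} {k : ℕ} {x y : Fin n}
    (h : IsTwinPair G k x y) : Safe G k (merge G x y) (k - 1) := by
  obtain ⟨hk, hxy, hc⟩ := h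
  refine ⟨by omega, ?_⟩
  rw [forest_identify_iff G k hxy hc, forest_merge_iff]
  constructor
  · exact fun h => ⟨k - 1, by omega, h⟩
  · rintro ⟨k', rfl, h⟩
    exact h

theorem IsBridgePair.card_edgeSet_lt {n : ℕ} {G : SimpleGraph (Fin n)} {x y : Fin n}
    (h : IsBridgePair G x y) : (G.deleteEdges {s(x, y)}).edgeSet.ncard < G.edgeSet.ncard := by
  refine Set.ncard_lt_ncard ?_ (Set.toFinite _)
  rw [SimpleGraph.edgeSet_deleteEdges]
  refine ⟨Set.sdiff_subset, fun hsub => ?_⟩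
  exact (hsub (show s(x, y) ∈ G.edgeSet from h.1)).2 rfl

/-- The two edges to a common neighbour become one edge. -/
theorem IsTwinPair.card_edgeSet_lt {n : ℕ} {G : SimpleGraph (Fin n)} {k : ℕ} {u v : Fin n}
    (h : IsTwinPair G k u v) : (merge G u v).edgeSet.ncard < G.edgeSet.ncard := by
  obtain ⟨-, huv, hc⟩ := h
  have hne : (G.commonNeighbors u v).Nonempty := by
    rw [← Set.ncard_pos]
    omega
  obtain ⟨w, huw, hvw⟩ := hne
  rw [SimpleGraph.mem_neighborSet] at huw hvw
  let f : Fin n → Fin n := fun x => if x = v then u else x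
  have hf : ∀ x, x ≠ v → f x = x := fun x hx => if_neg hx
  have hfv : f v = u := if_pos rfl
  have hsub : (merge G u v).edgeSet ⊆ Sym2.map f '' (G.edgeSet \ {s(v, w)}) := by
    have key : ∀ x y a b, G.Adj x y → f x = a → f y = b →
        s(a, b) ∈ Sym2.map f '' (G.edgeSet \ {s(v, w)}) := by
      rintro x y a b hxy rfl rfl
      by_cases he : s(x, y) = s(v, w)
      · refine ⟨s(u, w), ⟨huw, fun h => ?_⟩, ?_⟩
        · rw [Set.mem_singleton_iff, Sym2.eq_iff] at h
          rcases h with ⟨h, -⟩ | ⟨h, -⟩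
          exacts [huv h, huw.ne h]
        · have h1 := congrArg (Sym2.map f) he
          rw [Sym2.map_mk, Sym2.map_mk] at h1
          rw [h1, Sym2.map_mk, hfv, hf u huv]
      · exact ⟨s(x, y), ⟨hxy, he⟩, rfl⟩
    intro e
    induction e with
    | _ a b =>
      rintro ⟨-, hav, hbv, h | ⟨rfl, h⟩ | ⟨rfl, h⟩⟩
      · exact key a b a b h (hf a hav) (hf b hbv)
      · exact key v b a b h hfv (hf b hbv)
      · exact key a v a b h (hf a hav) hfv
  have h1 := Set.ncard_le_ncard hsub (Set.toFinite _)
  have h2 := Set.ncard_image_le (f := Sym2.map f) (Set.toFinite (G.edgeSet \ {s(v, w)}))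
  have h3 : (G.edgeSet \ {s(v, w)}).ncard < G.edgeSet.ncard :=
    Set.ncard_sdiff_singleton_lt_of_mem hvw
  omega

/-- Delete the edge between the vertices in variables `4` and `5`, if it is a bridge: restore it
if the deletion has not separated its ends. -/
def bridgeProg : LoopProg :=
  .ite (entry 4 5)
    (.seq (setEdge 4 5 0) (.seq (.assign 6 (.var 4)) (.seq reachProg
      (.ite (.get 2 (.var 5)) (setEdge 4 5 1) .skip)))) .skip

theorem bridgeProg_spec {n : ℕ} {s : Store} {G : SimpleGraph (Fin n)} (h : Holds s G)
    {x y : Fin n} (hx : s.var 4 = x) (hy : s.var 5 = y) :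
    (IsBridgePair G x y ∧ Holds (bridgeProg.run s) (G.deleteEdges {s(x, y)})) ∨
      (¬ IsBridgePair G x y ∧ Holds (bridgeProg.run s) G) := by
  have he := h.entry_ne_zero hx hy
  by_cases c1 : (entry 4 5).eval s ≠ 0
  swap
  · refine Or.inr ⟨fun hb => c1 (he.2 hb.1), ?_⟩
    rwa [bridgeProg, run, if_neg c1]
  set s1 := (setEdge 4 5 0).run s with hs1
  set s2 := s1.setVar 6 ((Expr.var 4).eval s1) with hs2
  have hrun : bridgeProg.run s = if (reachProg.run s2).arr 2 ((reachProg.run s2).var 5) ≠ 0 then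
      (setEdge 4 5 1).run (reachProg.run s2) else reachProg.run s2 := by
    rw [bridgeProg, run, if_pos c1]
    rfl
  rw [he] at c1
  have h4 : s1.var 4 = x := by rw [hs1, (run_frame _ s).1 4 (by decide), hx]
  have h5 : s1.var 5 = y := by rw [hs1, (run_frame _ s).1 5 (by decide), hy]
  have h2 : Holds s2 (G.deleteEdges {s(x, y)}) := (h.deleteEdge hx hy).setVar (by decide) _
  have h3 := reachProg_spec h2 (u := x) (by simp [hs2, Expr.eval, h4]) y
  have h6 : (reachProg.run s2).var 5 = y := by
    rw [(run_frame _ s2).1 5 (by decide)]; simp [hs2, h5]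
  have h7 : (reachProg.run s2).var 4 = x := by
    rw [(run_frame _ s2).1 4 (by decide)]; simp [hs2, h4]
  have h8 := h2.frame reachProg (by decide) (by decide) (by decide)
  rw [hrun, h6]
  by_cases c2 : (reachProg.run s2).arr 2 y ≠ 0
  · rw [if_pos c2]
    refine Or.inr ⟨fun hb => SimpleGraph.isBridge_iff.1 hb.2 (h3.1 c2), ?_⟩
    have h9 := h8.addEdge c1.ne h7 h6
    rwa [deleteEdges_sup_edge c1] at h9
  · rw [if_neg c2]
    exact Or.inl ⟨⟨c1, SimpleGraph.isBridge_iff.2 fun hr => c2 (h3.2 hr)⟩, h8⟩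

/-- An expression that is not `0` if and only if the variables `x` and `y` differ. -/
def neExpr (x y : ℕ) : Expr := .add (.sub (.var x) (.var y)) (.sub (.var y) (.var x))

theorem neExpr_ne_zero (s : Store) (x y : ℕ) : (neExpr x y).eval s ≠ 0 ↔ s.var x ≠ s.var y := by
  simp only [neExpr, Expr.eval]
  omega

/-- Move the edges of the vertex in variable `5` to the vertex in variable `4`. -/
def mergeProg : LoopProg :=
  .loop 10 (.ite (entry 5 10)
    (.seq (setEdge 5 10 0) (.ite (neExpr 4 10) (setEdge 4 10 1) .skip)) .skip)

theorem mergeProg_spec {n : ℕ} {s : Store} {G : SimpleGraph (Fin n)} (h : Holds s G)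
    {u v : Fin n} (huv : u ≠ v) (hu : s.var 4 = u) (hv : s.var 5 = v) :
    Holds (mergeProg.run s) (merge G u v) := by
  have key := run_loop (x := 10) (s := s) (P := .ite (entry 5 10)
    (.seq (setEdge 5 10 0) (.ite (neExpr 4 10) (setEdge 4 10 1) .skip)) .skip)
    (fun c s' => ∃ G' : SimpleGraph (Fin n), Holds s' G' ∧ ∀ a b : Fin n, G'.Adj a b ↔
      (G.Adj a b ∧ ¬(a = v ∧ (b : ℕ) < c) ∧ ¬(b = v ∧ (a : ℕ) < c)) ∨
      (a ≠ b ∧ ((a = u ∧ (b : ℕ) < c ∧ G.Adj v b) ∨ (b = u ∧ (a : ℕ) < c ∧ G.Adj v a))))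
    (fun _ _ _ ⟨G', h1, h2⟩ => ⟨G', h1.setVar (by decide) _, h2⟩)
    ⟨G, h, fun a b => by simp⟩ ?_
  · obtain ⟨G', h1, h2⟩ := key
    rw [h.card] at h2
    have : G' = merge G u v := by
      ext a b
      rw [h2]
      simp only [a.2, b.2, merge, and_true, true_and]
      rw [SimpleGraph.adj_comm G a v]
      by_cases ha : a = v
      · subst ha
        grind [SimpleGraph.Adj.ne]
      · by_cases hb : b = v
        · subst hb
          grind [SimpleGraph.Adj.ne]
        · grind [SimpleGraph.Adj.ne]
    rwa [← this]
  · intro i hi s' hx hfv hfa ⟨G', h1, h2⟩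
    rw [h.card] at hi
    have h4 : s'.var 4 = u := by rw [hfv 4 (by decide), hu]
    have h5 : s'.var 5 = v := by rw [hfv 5 (by decide), hv]
    set w : Fin n := ⟨i, hi⟩ with hw
    have he := h1.entry_ne_zero (x := 5) (y := 10) (i := v) (j := w) h5 hx
    have hlt : ∀ a : Fin n, (a : ℕ) < i + 1 ↔ (a : ℕ) < i ∨ a = w := fun a => by
      rw [Fin.ext_iff, show (w : ℕ) = i from rfl]; omega
    have hltw : ¬ (w : ℕ) < i := by simp [hw]
    have hvw : G'.Adj v w ↔ G.Adj v w := by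
      rw [h2]
      constructor
      · rintro (h | ⟨-, ⟨h, -⟩ | ⟨rfl, -, h⟩⟩)
        · exact h.1
        · exact (huv h.symm).elim
        · exact (h.ne rfl).elim
      · intro h
        refine Or.inl ⟨h, fun h => hltw h.2, fun h' => h.ne h'.1.symm⟩
    simp only [run]
    split_ifs with c1 c2
    · rw [he, hvw] at c1
      have h6 := h1.deleteEdge h5 (j := w) hx
      rw [neExpr_ne_zero, (run_frame _ _).1 4 (by decide), (run_frame _ _).1 10 (by decide), h4,
        hx] at c2
      have huw : u ≠ w := fun h => c2 (congrArg Fin.val h)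
      have h7 := h6.addEdge (x := 4) (y := 10) huw
        (by rw [(run_frame _ _).1 4 (by decide), h4])
        (by rw [(run_frame _ _).1 10 (by decide), hx])
      refine ⟨_, h7, fun a b => ?_⟩
      simp only [SimpleGraph.sup_adj, SimpleGraph.deleteEdges_adj, SimpleGraph.edge_adj, h2, hlt,
        Set.mem_singleton_iff, Sym2.eq_iff]
      grind [SimpleGraph.Adj.ne]
    · rw [he, hvw] at c1
      have h6 := h1.deleteEdge h5 (j := w) hx
      rw [neExpr_ne_zero, (run_frame _ _).1 4 (by decide), (run_frame _ _).1 10 (by decide), h4,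
        hx, not_not] at c2
      have huw : u = w := Fin.ext c2
      refine ⟨_, h6, fun a b => ?_⟩
      simp only [SimpleGraph.deleteEdges_adj, h2, hlt, Set.mem_singleton_iff, Sym2.eq_iff]
      grind [SimpleGraph.Adj.ne]
    · rw [he, hvw] at c1
      refine ⟨_, h1, fun a b => ?_⟩
      simp only [h2, hlt]
      grind [SimpleGraph.adj_comm]

/-! ### Exhaustive application of the rules -/

/-- The extension of a predicate on `Fin n` to the natural numbers, false from `n` on. -/
def natPred {n : ℕ} (p : Fin n → Prop) (w : ℕ) : Prop := ∃ h : w < n, p ⟨w, h⟩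

theorem natPred_coe {n : ℕ} {p : Fin n → Prop} (w : Fin n) : natPred p w ↔ p w :=
  ⟨fun ⟨_, h⟩ => h, fun h => ⟨w.2, h⟩⟩

/-- The number of `w < c` such that `p w`. -/
noncomputable def countBelow {n : ℕ} (p : Fin n → Prop) (c : ℕ) : ℕ :=
  @Nat.count (natPred p) (Classical.decPred _) c

theorem countBelow_zero {n : ℕ} (p : Fin n → Prop) : countBelow p 0 = 0 :=
  @Nat.count_zero _ (Classical.decPred _)

theorem countBelow_succ_of_pos {n : ℕ} {p : Fin n → Prop} {c : Fin n} (h : p c) :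
    countBelow p (c + 1) = countBelow p c + 1 := by
  classical
  rw [countBelow, Nat.count_succ, if_pos ((natPred_coe c).2 h), countBelow]

theorem countBelow_succ_of_neg {n : ℕ} {p : Fin n → Prop} {c : Fin n} (h : ¬ p c) :
    countBelow p (c + 1) = countBelow p c := by
  classical
  rw [countBelow, Nat.count_succ, if_neg (fun h' => h ((natPred_coe c).1 h')), countBelow]
  rfl

theorem countBelow_eq_ncard {n : ℕ} (p : Fin n → Prop) : countBelow p n = {w | p w}.ncard := by
  classical
  rw [countBelow, Nat.count_eq_card_filter_range, ← Set.ncard_coe_finset,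
    ← Set.ncard_image_of_injective _ Fin.val_injective]
  congr 1
  ext w
  simp only [Finset.coe_filter, Finset.mem_range, Set.mem_ofPred_eq, Set.mem_image]
  constructor
  · rintro ⟨-, h, hp⟩
    exact ⟨⟨w, h⟩, hp, rfl⟩
  · rintro ⟨v, hp, rfl⟩
    exact ⟨v.2, v.2, hp⟩

/-- Count in variable `11` the common neighbours of the vertices in variables `4` and `5`. -/
def countProg : LoopProg :=
  .seq (.assign 11 (.const 0)) (.loop 10 (.ite (entry 4 10) (.ite (entry 5 10)
    (.assign 11 (.add (.var 11) (.const 1))) .skip) .skip))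

theorem countProg_spec {n : ℕ} {s : Store} {G : SimpleGraph (Fin n)} (h : Holds s G)
    {x y : Fin n} (hx : s.var 4 = x) (hy : s.var 5 = y) :
    (countProg.run s).var 11 = (G.commonNeighbors x y).ncard := by
  have key := run_loop (x := 10) (s := s.setVar 11 0) (P := .ite (entry 4 10) (.ite (entry 5 10)
    (.assign 11 (.add (.var 11) (.const 1))) .skip) .skip)
    (fun c s' => s'.var 11 = countBelow (fun w => w ∈ G.commonNeighbors x y) c)
    (fun _ _ _ h => by simpa using h) (by simp [countBelow_zero]) ?_
  · have h0 : (s.setVar 11 0).var 0 = n := by simp [h.card]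
    rw [h0, countBelow_eq_ncard] at key
    exact key
  · intro i hi s' hi' hfv hfa hI
    have h1 : Holds s' G := h.of_eq (hfv 0 (by decide)) (hfa 0 (by decide)) (hfa 1 (by decide))
    rw [show (s.setVar 11 0).var 0 = n by simp [h.card]] at hi
    have h4 := h1.entry_ne_zero (x := 4) (y := 10) (j := ⟨i, hi⟩)
      (by rw [hfv 4 (by decide)]; simpa using hx) hi'
    have h5 := h1.entry_ne_zero (x := 5) (y := 10) (j := ⟨i, hi⟩)
      (by rw [hfv 5 (by decide)]; simpa using hy) hi'
    simp only [run]
    split_ifs with c1 c2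
    · simp only [Expr.eval, Store.setVar_var, if_true, hI]
      exact (countBelow_succ_of_pos (p := fun w => w ∈ G.commonNeighbors x y) (c := ⟨i, hi⟩)
        ⟨h4.1 c1, h5.1 c2⟩).symm
    · rw [hI]
      exact (countBelow_succ_of_neg (p := fun w => w ∈ G.commonNeighbors x y) (c := ⟨i, hi⟩)
        fun h => c2 (h5.2 h.2)).symm
    · rw [hI]
      exact (countBelow_succ_of_neg (p := fun w => w ∈ G.commonNeighbors x y) (c := ⟨i, hi⟩)
        fun h => c1 (h4.2 h.1)).symm

/-- Identify the vertices in variables `4` and `5`, if they have too many common neighbours. -/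
def twinProg : LoopProg :=
  .ite (.var 1) (.ite (neExpr 4 5) (.seq countProg
    (.ite (.sub (.var 11) (.add (.var 1) (.const 1)))
      (.seq mergeProg (.assign 1 (.sub (.var 1) (.const 1)))) .skip)) .skip) .skip

theorem twinProg_spec {n : ℕ} {s : Store} {G : SimpleGraph (Fin n)} (h : Holds s G)
    {x y : Fin n} (hx : s.var 4 = x) (hy : s.var 5 = y) :
    (IsTwinPair G (s.var 1) x y ∧ Holds (twinProg.run s) (merge G x y) ∧
        (twinProg.run s).var 1 = s.var 1 - 1) ∨
      (¬ IsTwinPair G (s.var 1) x y ∧ Holds (twinProg.run s) G ∧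
        (twinProg.run s).var 1 = s.var 1) := by
  by_cases c1 : s.var 1 = 0
  · refine Or.inr ⟨fun h => by have := h.1; omega, ?_⟩
    rw [twinProg, run, if_neg (by simpa [Expr.eval] using c1)]
    exact ⟨h, rfl⟩
  have hrun : twinProg.run s = if (neExpr 4 5).eval s ≠ 0 then
      (LoopProg.ite (.sub (.var 11) (.add (.var 1) (.const 1)))
        (.seq mergeProg (.assign 1 (.sub (.var 1) (.const 1)))) .skip).run (countProg.run s)
      else s := by
    rw [twinProg, run, if_pos (by simpa [Expr.eval] using c1)]
    rfl
  rw [hrun]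
  by_cases c2 : x = y
  · refine Or.inr ⟨fun h => h.2.1 c2, ?_⟩
    rw [if_neg (by rw [neExpr_ne_zero, hx, hy, c2]; simp)]
    exact ⟨h, rfl⟩
  rw [if_pos (by rw [neExpr_ne_zero, hx, hy]; exact fun h => c2 (Fin.ext h))]
  have h1 := h.frame countProg (by decide) (by decide) (by decide)
  have e1 := (run_frame countProg s).1 1 (by decide)
  have e4 := ((run_frame countProg s).1 4 (by decide)).trans hx
  have e5 := ((run_frame countProg s).1 5 (by decide)).trans hy
  have hc := countProg_spec h hx hy
  rw [run]
  have hev : (Expr.sub (.var 11) (.add (.var 1) (.const 1))).eval (countProg.run s) =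
      (G.commonNeighbors x y).ncard - (s.var 1 + 1) := by simp only [Expr.eval, hc, e1]
  rw [hev]
  by_cases c3 : s.var 1 + 1 < (G.commonNeighbors x y).ncard
  · rw [if_pos (by omega)]
    refine Or.inl ⟨⟨by omega, c2, c3⟩, ?_⟩
    have h2 := mergeProg_spec h1 c2 e4 e5
    refine ⟨h2.setVar (by decide) _, ?_⟩
    simp only [run, Store.setVar_var, if_true, Expr.eval]
    rw [(run_frame mergeProg _).1 1 (by decide), e1]
  · rw [if_neg (by omega)]
    exact Or.inr ⟨fun h => c3 h.2.2, h1, e1⟩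

/-- One of the rules applies to the pair `(x, y)`. -/
def Applicable {n : ℕ} (G : SimpleGraph (Fin n)) (k : ℕ) (x y : Fin n) : Prop :=
  IsBridgePair G x y ∨ IsTwinPair G k x y

/-- No rule applies. With the parameter `0`, only bridges count, since an identification lowers the
parameter. -/
def Irreducible {n : ℕ} (G : SimpleGraph (Fin n)) (k : ℕ) : Prop := ∀ x y, ¬ Applicable G k x y

/-- Try both rules on the pair of vertices in variables `4` and `5`. -/
def ruleProg : LoopProg := .seq bridgeProg twinProg

theorem ruleProg_spec {n : ℕ} {s : Store} {G : SimpleGraph (Fin n)} (h : Holds s G)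
    {x y : Fin n} (hx : s.var 4 = x) (hy : s.var 5 = y) :
    ∃ G' : SimpleGraph (Fin n), Holds (ruleProg.run s) G' ∧
      Safe G (s.var 1) G' ((ruleProg.run s).var 1) ∧
      ((¬ Applicable G (s.var 1) x y ∧ G' = G ∧ (ruleProg.run s).var 1 = s.var 1) ∨
        (Applicable G (s.var 1) x y ∧ G'.edgeSet.ncard < G.edgeSet.ncard)) := by
  have e1 := (run_frame bridgeProg s).1 1 (by decide)
  have e4 := ((run_frame bridgeProg s).1 4 (by decide)).trans hx
  have e5 := ((run_frame bridgeProg s).1 5 (by decide)).trans hy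
  have hr : ruleProg.run s = twinProg.run (bridgeProg.run s) := rfl
  rw [hr]
  rcases bridgeProg_spec h hx hy with ⟨hb, h1⟩ | ⟨hb, h1⟩ <;>
    rcases twinProg_spec h1 e4 e5 with ⟨ht, h2, h3⟩ | ⟨ht, h2, h3⟩ <;> rw [e1] at ht h3 <;>
    refine ⟨_, h2, ?_, ?_⟩ <;> rw [h3]
  · exact (hb.safe _).trans ht.safe
  · exact Or.inr ⟨Or.inl hb, ht.card_edgeSet_lt.trans hb.card_edgeSet_lt⟩
  · exact hb.safe _
  · exact Or.inr ⟨Or.inl hb, hb.card_edgeSet_lt⟩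
  · exact ht.safe
  · exact Or.inr ⟨Or.inr ht, ht.card_edgeSet_lt⟩
  · exact Safe.refl _ _
  · exact Or.inl ⟨by rintro (h | h); exacts [hb h, ht h], rfl, rfl⟩

/-- Try both rules on all pairs of vertices. -/
def sweepProg : LoopProg := .loop 4 (.loop 5 ruleProg)

theorem sweepProg_spec {n : ℕ} {s : Store} {G : SimpleGraph (Fin n)} (h : Holds s G) :
    ∃ G' : SimpleGraph (Fin n), Holds (sweepProg.run s) G' ∧
      Safe G (s.var 1) G' ((sweepProg.run s).var 1) ∧
      ((Irreducible G (s.var 1) ∧ G' = G ∧ (sweepProg.run s).var 1 = s.var 1) ∨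
        (¬ Irreducible G (s.var 1) ∧ G'.edgeSet.ncard < G.edgeSet.ncard)) := by
  have key := run_loop_loop (x := 4) (y := 5) (P := ruleProg) (s := s)
    (fun c s' => ∃ G' : SimpleGraph (Fin n), Holds s' G' ∧ Safe G (s.var 1) G' (s'.var 1) ∧
      (((∀ x y : Fin n, (x : ℕ) * n + y < c → ¬ Applicable G (s.var 1) x y) ∧ G' = G ∧
        s'.var 1 = s.var 1) ∨ (¬ Irreducible G (s.var 1) ∧
        G'.edgeSet.ncard < G.edgeSet.ncard)))
    (fun _ _ _ ⟨G', h1, h2⟩ => ⟨G', h1.setVar (by decide) _, by simpa using h2⟩)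
    (fun _ _ _ ⟨G', h1, h2⟩ => ⟨G', h1.setVar (by decide) _, by simpa using h2⟩)
    (by decide) (by decide) (by decide)
    ⟨G, h, Safe.refl _ _, Or.inl ⟨fun x y hxy => by omega, rfl, rfl⟩⟩ ?_
  · obtain ⟨G', h1, h2, h3⟩ := key
    refine ⟨G', h1, h2, h3.imp_left fun h4 => ⟨fun x y => h4.1 x y ?_, h4.2⟩⟩
    rw [h.card]
    exact addr_lt x.2 y.2
  · intro i hi j hj s' hx hy _ _ ⟨G1, h1, h2, h3⟩
    rw [h.card] at hi hj h3 ⊢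
    obtain ⟨G2, h4, h5, h6⟩ := ruleProg_spec h1 (x := ⟨i, hi⟩) (y := ⟨j, hj⟩) hx hy
    refine ⟨G2, h4, h2.trans h5, ?_⟩
    rcases h3 with ⟨h7, rfl, h8⟩ | ⟨h7, h8⟩
    · rw [h8] at h6
      refine h6.imp (fun h6 => ⟨fun x y hxy => ?_, h6.2⟩) (fun h6 => ⟨fun h => h _ _ h6.1, h6.2⟩)
      rw [addr_lt_succ y.2 hj] at hxy
      rcases hxy with hxy | ⟨hx, hy⟩
      · exact h7 x y hxy
      · rw [show x = ⟨i, hi⟩ from Fin.ext hx, show y = ⟨j, hj⟩ from Fin.ext hy]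
        exact h6.1
    · refine Or.inr ⟨h7, ?_⟩
      rcases h6 with ⟨-, rfl, -⟩ | ⟨-, h6⟩
      · exact h8
      · exact h6.trans h8

/-- Apply the rules exhaustively: each of `n * n` sweeps lowers the number of edges or finds
that no rule applies. -/
def saturateProg : LoopProg := .loop 2 (.loop 3 sweepProg)

theorem irreducible_bot {n : ℕ} (k : ℕ) : Irreducible (⊥ : SimpleGraph (Fin n)) k := by
  rintro x y (⟨h, -⟩ | ⟨-, -, h⟩)
  · exact h
  · have : (⊥ : SimpleGraph (Fin n)).commonNeighbors x y = ∅ := by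
      ext w
      simp
    rw [this, Set.ncard_empty] at h
    omega

theorem saturateProg_spec {n : ℕ} {s : Store} {G : SimpleGraph (Fin n)} (h : Holds s G) :
    ∃ G' : SimpleGraph (Fin n), Holds (saturateProg.run s) G' ∧
      Safe G (s.var 1) G' ((saturateProg.run s).var 1) ∧
      Irreducible G' ((saturateProg.run s).var 1) := by
  have hle : G.edgeSet.ncard ≤ n * n := by
    have h1 : G.edgeSet.ncard ≤ Nat.card (Sym2 (Fin n)) := Set.ncard_le_card _
    have h2 : Nat.card (Sym2 (Fin n)) ≤ Nat.card (Fin n × Fin n) :=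
      Nat.card_le_card_of_surjective _ Sym2.mk_surjective
    rw [Nat.card_prod, Nat.card_fin] at h2
    omega
  have key := run_loop_loop (x := 2) (y := 3) (P := sweepProg) (s := s)
    (fun c s' => ∃ G' : SimpleGraph (Fin n), Holds s' G' ∧ Safe G (s.var 1) G' (s'.var 1) ∧
      (Irreducible G' (s'.var 1) ∨ G'.edgeSet.ncard + c ≤ n * n))
    (fun _ _ _ ⟨G', h1, h2⟩ => ⟨G', h1.setVar (by decide) _, by simpa using h2⟩)
    (fun _ _ _ ⟨G', h1, h2⟩ => ⟨G', h1.setVar (by decide) _, by simpa using h2⟩)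
    (by decide) (by decide) (by decide)
    ⟨G, h, Safe.refl _ _, Or.inr hle⟩ ?_
  · obtain ⟨G', h1, h2, h3⟩ := key
    refine ⟨G', h1, h2, ?_⟩
    rcases h3 with h3 | h3
    · exact h3
    · rw [h.card] at h3
      have h4 : G'.edgeSet.ncard = 0 := by omega
      rw [Set.ncard_eq_zero, SimpleGraph.edgeSet_eq_empty] at h4
      rw [h4]
      exact irreducible_bot _
  · intro i hi j hj s' _ _ _ _ ⟨G1, h1, h2, h3⟩
    obtain ⟨G2, h4, h5, h6⟩ := sweepProg_spec h1
    refine ⟨G2, h4, h2.trans h5, ?_⟩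
    rcases h6 with ⟨h7, rfl, h8⟩ | ⟨h7, h8⟩
    · rw [h8]
      exact Or.inl h7
    · rcases h3 with h3 | h3
      · exact (h7 h3).elim
      · exact Or.inr (by omega)

/-! ### Connecting the components -/

/-- Set variable `13` to `1` if the vertex in variable `12` has a neighbour, to `0` otherwise. -/
def isolatedProg : LoopProg :=
  .seq (.assign 13 (.const 0)) (.loop 10 (.ite (entry 12 10) (.assign 13 (.const 1)) .skip))

theorem isolatedProg_spec {n : ℕ} {s : Store} {G : SimpleGraph (Fin n)} (h : Holds s G)
    {v : Fin n} (hv : s.var 12 = v) : (isolatedProg.run s).var 13 ≠ 0 ↔ ¬ G.IsIsolated v := by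
  have h0 : (s.setVar 13 0).var 0 = n := by simp [h.card]
  have key := run_loop (x := 10) (s := s.setVar 13 0)
    (P := .ite (entry 12 10) (.assign 13 (.const 1)) .skip)
    (fun c s' => s'.var 13 ≠ 0 ↔ ∃ w : Fin n, (w : ℕ) < c ∧ G.Adj v w)
    (fun _ _ _ h => by simpa using h) (by simp) ?_
  · rw [h0] at key
    refine key.trans ?_
    simp [SimpleGraph.IsIsolated]
  · intro i hi s' hi' hfv hfa hI
    have h1 : Holds s' G := h.of_eq (hfv 0 (by decide)) (hfa 0 (by decide)) (hfa 1 (by decide))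
    rw [h0] at hi
    have h4 := h1.entry_ne_zero (x := 12) (y := 10) (i := v) (j := ⟨i, hi⟩)
      (by rw [hfv 12 (by decide)]; simpa using hv) hi'
    simp only [run]
    split_ifs with c1
    · simp only [Expr.eval, Store.setVar_var, if_true]
      exact iff_of_true one_ne_zero ⟨⟨i, hi⟩, Nat.lt_succ_self i, h4.1 c1⟩
    · rw [hI]
      refine exists_congr fun w => and_congr_left fun hw => ?_
      rw [Nat.lt_succ_iff_lt_or_eq]
      refine ⟨Or.inl, fun h => h.resolve_right fun hwi => c1 (h4.2 ?_)⟩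
      rwa [show (⟨i, hi⟩ : Fin n) = w from Fin.ext hwi.symm]

/-- Join the vertex `0` to each vertex that is neither isolated nor in its component. -/
def connectProg : LoopProg :=
  .loop 12 (.seq isolatedProg (.ite (.var 13) (.seq (.assign 6 (.const 0)) (.seq reachProg
    (.ite (.get 2 (.var 12)) .skip (setEdge 6 12 1)))) .skip))

theorem safe_sup_edge {n : ℕ} {G : SimpleGraph (Fin n)} {x y : Fin n} (h : ¬ G.Reachable x y)
    (k : ℕ) : Safe G k (G ⊔ SimpleGraph.edge x y) k := ⟨le_rfl, forest_sup_edge_iff G k h⟩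

theorem connectProg_spec {n : ℕ} {s : Store} {G : SimpleGraph (Fin n)} (h : Holds s G) (k : ℕ) :
    ∃ G' : SimpleGraph (Fin n), Holds (connectProg.run s) G' ∧ Safe G k G' k ∧
      ∀ z : Fin n, (z : ℕ) = 0 → ∀ v, ¬ G'.IsIsolated v →
        G'.Reachable z v ∧ (v = z ∨ ¬ G.IsIsolated v) := by
  have key := run_loop (x := 12) (s := s)
    (P := .seq isolatedProg (.ite (.var 13) (.seq (.assign 6 (.const 0)) (.seq reachProg
      (.ite (.get 2 (.var 12)) .skip (setEdge 6 12 1)))) .skip))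
    (fun c s' => ∃ G' : SimpleGraph (Fin n), Holds s' G' ∧ Safe G k G' k ∧ G ≤ G' ∧
      ∀ z : Fin n, (z : ℕ) = 0 → (∀ v, ¬ G'.IsIsolated v → v = z ∨ ¬ G.IsIsolated v) ∧
        ∀ v : Fin n, (v : ℕ) < c → ¬ G.IsIsolated v → G'.Reachable z v)
    (fun _ _ _ ⟨G', h1, h2⟩ => ⟨G', h1.setVar (by decide) _, h2⟩)
    ⟨G, h, Safe.refl _ _, le_rfl, fun z hz => ⟨fun v => Or.inr, fun v hv => by omega⟩⟩ ?_
  · obtain ⟨G', h1, h2, h3, h4⟩ := key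
    refine ⟨G', h1, h2, fun z hz v hv => ?_⟩
    have h5 := (h4 z hz).1 v hv
    refine ⟨?_, h5⟩
    rcases h5 with rfl | h5
    · exact .rfl
    · exact (h4 z hz).2 v (by rw [h.card]; exact v.2) h5
  · intro i hi s' hi' hfv hfa ⟨G1, h1, h2, h3, h4⟩
    rw [h.card] at hi
    set v : Fin n := ⟨i, hi⟩ with hv
    have hlt : ∀ w : Fin n, (w : ℕ) < i + 1 → (w : ℕ) < i ∨ w = v := fun w hw => by
      rw [Fin.ext_iff, show (v : ℕ) = i from rfl]; omega
    have h5 := isolatedProg_spec h1 (v := v) hi'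
    set s1 := isolatedProg.run s' with hs1
    set s2 := s1.setVar 6 0 with hs2
    have hrun : (LoopProg.seq isolatedProg (.ite (.var 13) (.seq (.assign 6 (.const 0))
        (.seq reachProg (.ite (.get 2 (.var 12)) .skip (setEdge 6 12 1)))) .skip)).run s' =
        if s1.var 13 ≠ 0 then
          (if (reachProg.run s2).arr 2 ((reachProg.run s2).var 12) ≠ 0 then reachProg.run s2
            else (setEdge 6 12 1).run (reachProg.run s2))
        else s1 := rfl
    rw [hrun]
    have hH1 : Holds s1 G1 := h1.frame _ (by decide) (by decide) (by decide)
    by_cases c1 : s1.var 13 ≠ 0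
    swap
    · rw [if_neg c1]
      refine ⟨G1, hH1, h2, h3, fun z hz => ⟨(h4 z hz).1, fun w hw hiso => ?_⟩⟩
      rcases hlt w hw with hw | rfl
      · exact (h4 z hz).2 w hw hiso
      · rw [h5, not_not] at c1
        exact (hiso fun x hx => c1 x (h3 hx)).elim
    rw [if_pos c1]
    let z : Fin n := ⟨0, by omega⟩
    have hH2 : Holds s2 G1 := hH1.setVar (by decide) _
    have h6 := reachProg_spec hH2 (u := z) (by simp [hs2, z])
    have h7 : (reachProg.run s2).var 12 = v := by
      rw [(run_frame reachProg _).1 12 (by decide)]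
      simp only [hs2, Store.setVar_var]
      rw [if_neg (by decide), hs1, (run_frame isolatedProg _).1 12 (by decide), hi']
    have h8 : (reachProg.run s2).var 6 = z := by
      rw [(run_frame reachProg _).1 6 (by decide)]
      simp [hs2, z]
    have hH3 : Holds (reachProg.run s2) G1 := hH2.frame _ (by decide) (by decide) (by decide)
    have hz' : ∀ w : Fin n, (w : ℕ) = 0 → w = z := fun w hw => Fin.ext hw
    rw [h7]
    by_cases c2 : (reachProg.run s2).arr 2 v ≠ 0
    · rw [if_pos c2]
      refine ⟨G1, hH3, h2, h3, fun z' hz => ⟨(h4 z' hz).1, fun w hw hiso => ?_⟩⟩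
      rcases hlt w hw with hw | rfl
      · exact (h4 z' hz).2 w hw hiso
      · rw [hz' z' hz]
        exact (h6 _).1 c2
    · rw [if_neg c2]
      have hnr : ¬ G1.Reachable z v := fun hr => c2 ((h6 v).2 hr)
      have hzv : z ≠ v := fun h => hnr (h ▸ .rfl)
      refine ⟨_, hH3.addEdge hzv h8 h7, h2.trans (safe_sup_edge hnr k), h3.trans le_sup_left,
        fun z' hz => ?_⟩
      rw [hz' z' hz]
      have h9 := h4 z rfl
      refine ⟨fun w hw => ?_, fun w hw hiso => ?_⟩
      · rcases eq_or_ne w z with h10 | h10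
        · exact Or.inl h10
        refine h9.1 w ?_
        rcases eq_or_ne w v with rfl | h11
        · exact h5.1 c1
        · intro hiso
          refine hw fun x hx => ?_
          rw [SimpleGraph.sup_adj, SimpleGraph.edge_adj] at hx
          rcases hx with hx | ⟨⟨h12, -⟩ | ⟨h12, -⟩, -⟩
          exacts [hiso x hx, h10 h12, h11 h12]
      · rcases hlt w hw with hw | rfl
        · exact (h9.2 w hw hiso).mono le_sup_left
        · refine SimpleGraph.Adj.reachable ?_
          rw [SimpleGraph.sup_adj, SimpleGraph.edge_adj]
          exact Or.inr ⟨Or.inl ⟨rfl, rfl⟩, hzv⟩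

/-! ### Counting components -/

/-- Count in variable `21` the vertices that are the least ones of their components. -/
def componentsProg : LoopProg :=
  .seq (.assign 21 (.const 0)) (.loop 12 (.seq (.assign 6 (.var 12)) (.seq reachProg
    (.seq (.assign 13 (.const 1)) (.seq (.loop 10 (.ite (.get 2 (.var 10))
      (.ite (.sub (.var 12) (.var 10)) (.assign 13 (.const 0)) .skip) .skip))
      (.assign 21 (.add (.var 21) (.var 13))))))))

theorem ncard_least_eq_card_connectedComponent {n : ℕ} (G : SimpleGraph (Fin n)) :
    {v : Fin n | ∀ w < v, ¬ G.Reachable v w}.ncard = Nat.card G.ConnectedComponent := by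
  rw [← Nat.card_coe_set_eq]
  refine Nat.card_eq_of_bijective
    (fun v : {v : Fin n | ∀ w < v, ¬ G.Reachable v w} => G.connectedComponentMk v) ⟨?_, ?_⟩
  · rintro ⟨v, hv⟩ ⟨w, hw⟩ h
    have hr : G.Reachable v w := SimpleGraph.ConnectedComponent.exact h
    refine Subtype.ext (le_antisymm ?_ ?_)
    · exact not_lt.1 fun hlt => hv w hlt hr
    · exact not_lt.1 fun hlt => hw v hlt hr.symm
  · intro c
    obtain ⟨v, hv, hmin⟩ := Set.exists_min_image c.supp id (Set.toFinite _) c.nonempty_supp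
    refine ⟨⟨v, fun w hw hr => ?_⟩, hv⟩
    refine not_lt.2 (hmin w ?_) hw
    rw [SimpleGraph.ConnectedComponent.mem_supp_iff] at hv ⊢
    rw [← hv]
    exact SimpleGraph.ConnectedComponent.sound hr.symm

theorem componentsProg_spec {n : ℕ} {s : Store} {G : SimpleGraph (Fin n)} (h : Holds s G) :
    (componentsProg.run s).var 21 = Nat.card G.ConnectedComponent := by
  have h0 : (s.setVar 21 0).var 0 = n := by simp [h.card]
  set p : Fin n → Prop := fun v => ∀ w < v, ¬ G.Reachable v w with hp
  have key := run_loop (x := 12) (s := s.setVar 21 0)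
    (P := .seq (.assign 6 (.var 12)) (.seq reachProg (.seq (.assign 13 (.const 1))
      (.seq (.loop 10 (.ite (.get 2 (.var 10)) (.ite (.sub (.var 12) (.var 10))
        (.assign 13 (.const 0)) .skip) .skip)) (.assign 21 (.add (.var 21) (.var 13)))))))
    (fun c s' => s'.var 21 = countBelow p c) (fun _ _ _ h => by simpa using h)
    (by simp [countBelow_zero]) ?_
  · rw [h0, countBelow_eq_ncard, ncard_least_eq_card_connectedComponent] at key
    exact key
  · intro i hi s' hi' hfv hfa hI
    rw [h0] at hi
    set v : Fin n := ⟨i, hi⟩ with hv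
    have h1 : Holds s' G := h.of_eq (hfv 0 (by decide)) (hfa 0 (by decide)) (hfa 1 (by decide))
    have h2 : Holds (s'.setVar 6 i) G := h1.setVar (by decide) _
    have h3 := reachProg_spec h2 (u := v) (by simp [hv])
    set s2 := reachProg.run (s'.setVar 6 i) with hs2
    have e12 : s2.var 12 = i := by
      rw [hs2, (run_frame reachProg _).1 12 (by decide)]; simpa using hi'
    have e21 : s2.var 21 = countBelow p i := by
      rw [hs2, (run_frame reachProg _).1 21 (by decide)]; simpa using hI
    have e0 : (s2.setVar 13 1).var 0 = n := by
      simp [hs2, (run_frame reachProg _).1 0 (by decide), h1.card]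
    set L : LoopProg := .loop 10 (.ite (.get 2 (.var 10)) (.ite (.sub (.var 12) (.var 10))
        (.assign 13 (.const 0)) .skip) .skip) with hL
    have k2 := run_loop (x := 10) (s := s2.setVar 13 1)
      (P := .ite (.get 2 (.var 10)) (.ite (.sub (.var 12) (.var 10))
        (.assign 13 (.const 0)) .skip) .skip)
      (fun c s' => (s'.var 13 = 1 ∧ ∀ w : Fin n, (w : ℕ) < c → w < v → ¬ G.Reachable v w) ∨
        (s'.var 13 = 0 ∧ ¬ p v)) (fun _ _ _ h => by simpa using h)
      (Or.inl ⟨by simp, fun w hw => by omega⟩) ?_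
    · rw [e0] at k2
      have hrun : (LoopProg.seq (.assign 6 (.var 12)) (.seq reachProg
          (.seq (.assign 13 (.const 1)) (.seq L (.assign 21 (.add (.var 21) (.var 13))))))).run s'
          = (L.run (s2.setVar 13 1)).setVar 21
            ((L.run (s2.setVar 13 1)).var 21 + (L.run (s2.setVar 13 1)).var 13) := by
        simp only [run, Expr.eval, hi', hs2]
      rw [hrun, Store.setVar_var, if_pos rfl, (run_frame L _).1 21 (by decide)]
      simp only [Store.setVar_var]
      rw [if_neg (by decide), e21]
      rcases k2 with ⟨k3, k4⟩ | ⟨k3, k4⟩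
      · rw [k3]
        exact (countBelow_succ_of_pos (p := p) (c := v) fun w hw => k4 w w.2 hw).symm
      · rw [k3]
        exact (countBelow_succ_of_neg (p := p) (c := v) k4).symm
    · intro j hj s3 hj' hfv hfa hI3
      rw [e0] at hj
      rcases hI3 with ⟨h13, hall⟩ | ⟨h13, hnp⟩
      swap
      · refine Or.inr ⟨?_, hnp⟩
        simp only [run]
        split_ifs
        · simp [Expr.eval]
        · exact h13
        · exact h13
      have f2 : s3.arr 2 = s2.arr 2 := hfa 2 (by decide)
      have f12 : s3.var 12 = i := by
        rw [hfv 12 (by decide)]; simpa using e12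
      have h3j := h3 ⟨j, hj⟩
      simp only at h3j
      simp only [run, Expr.eval, hj', f2, f12]
      split_ifs with c1 c2
      · refine Or.inr ⟨by simp, fun hpv => hpv ⟨j, hj⟩ ?_ (h3j.1 c1)⟩
        rw [Fin.lt_def]
        show j < i
        omega
      · refine Or.inl ⟨h13, fun w hw hwv => ?_⟩
        rcases Nat.lt_succ_iff_lt_or_eq.1 hw with hw | hw
        · exact hall w hw hwv
        · rw [Fin.lt_def, hw] at hwv
          have : j < i := hwv
          omega
      · refine Or.inl ⟨h13, fun w hw hwv => ?_⟩
        rcases Nat.lt_succ_iff_lt_or_eq.1 hw with hw | hw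
        · exact hall w hw hwv
        · rw [show w = ⟨j, hj⟩ from Fin.ext hw]
          exact fun hr => c1 (h3j.2 hr)

/-! ### Writing the output -/

/-- Store in array `a` the first `n` multiples of variable `x`. -/
def rowsProg (a x : ℕ) : LoopProg :=
  .seq (.assign 20 (.const 0)) (.loop 12 (.seq (.put a (.var 12) (.var 20))
    (.assign 20 (.add (.var 20) (.var x)))))

theorem rowsProg_spec (s : Store) (a x : ℕ) (hx : x ≠ 12 ∧ x ≠ 20) :
    ∀ i < s.var 0, ((rowsProg a x).run s).arr a i = i * s.var x := by
  have key := run_loop (x := 12) (s := s.setVar 20 0)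
    (P := .seq (.put a (.var 12) (.var 20)) (.assign 20 (.add (.var 20) (.var x))))
    (fun c s' => s'.var 20 = c * s.var x ∧ ∀ i < c, s'.arr a i = i * s.var x)
    (fun _ _ _ h => by simpa using h) (by simp) ?_
  · exact key.2
  · intro i hi s' hi' hfv _ ⟨h1, h2⟩
    have h3 : s'.var x = s.var x := by
      rw [hfv x (by simp [vars, hx])]
      simp [hx.2]
    refine ⟨?_, fun j hj => ?_⟩
    · simp only [run, Expr.eval, Store.setVar_var, if_true, Store.setArr_var, h1, h3]
      rw [Nat.succ_mul]
    · simp only [run, Expr.eval, Store.setVar_arr, Store.setArr_arr, true_and, hi', h1]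
      split_ifs with h4
      · rw [h4]
      · exact h2 j (by omega)

/-- The set of vertices that are marked in array `2`. -/
def marked (n : ℕ) (s : Store) (v : Fin n) : Prop := s.arr 2 v ≠ 0

/-- Number the marked vertices in array `4`, and count them in variable `15`. -/
def indexProg : LoopProg :=
  .seq (.assign 15 (.const 0)) (.loop 12 (.ite (.get 2 (.var 12))
    (.seq (.put 4 (.var 12) (.var 15)) (.assign 15 (.add (.var 15) (.const 1)))) .skip))

theorem indexProg_spec {n : ℕ} {s : Store} (hn : s.var 0 = n) :
    (indexProg.run s).var 15 = countBelow (marked n s) n ∧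
      ∀ v : Fin n, marked n s v → (indexProg.run s).arr 4 v = countBelow (marked n s) v := by
  have h0 : (s.setVar 15 0).var 0 = n := by simp [hn]
  have key := run_loop (x := 12) (s := s.setVar 15 0)
    (P := .ite (.get 2 (.var 12))
      (.seq (.put 4 (.var 12) (.var 15)) (.assign 15 (.add (.var 15) (.const 1)))) .skip)
    (fun c s' => s'.var 15 = countBelow (marked n s) c ∧ ∀ v : Fin n, (v : ℕ) < c →
      marked n s v → s'.arr 4 v = countBelow (marked n s) v)
    (fun _ _ _ h => by simpa using h) (by simp [countBelow_zero]) ?_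
  · rw [h0] at key
    exact ⟨key.1, fun v => key.2 v v.2⟩
  · intro i hi s' hi' hfv hfa ⟨h1, h2⟩
    rw [h0] at hi
    have f2 : s'.arr 2 = s.arr 2 := hfa 2 (by decide)
    simp only [run, Expr.eval, hi', f2]
    split_ifs with c1
    · refine ⟨?_, fun v hv hm => ?_⟩
      · simp only [Store.setVar_var, if_true, Store.setArr_var, h1]
        exact (countBelow_succ_of_pos (p := marked n s) (c := ⟨i, hi⟩) c1).symm
      · simp only [Store.setVar_arr, Store.setArr_arr, true_and, h1]
        split_ifs with h4
        · rw [h4]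
        · exact h2 v (by omega) hm
    · refine ⟨h1.trans (countBelow_succ_of_neg (p := marked n s) (c := ⟨i, hi⟩) c1).symm,
        fun v hv hm => ?_⟩
      rcases Nat.lt_succ_iff_lt_or_eq.1 hv with hv | hv
      · exact h2 v hv hm
      · refine (c1 ?_).elim
        rw [← hv]
        exact hm

/-- Copy the adjacency matrix to array `3`. -/
def copyProg : LoopProg := .loop 4 (.loop 5 (.put 3 (addr 4 5) (entry 4 5)))

theorem copyProg_spec {n : ℕ} {s : Store} {G : SimpleGraph (Fin n)} (h : Holds s G)
    (a b : Fin n) : (copyProg.run s).arr 3 (a * n + b) = s.arr 0 (a * n + b) := by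
  have key := run_loop_loop (x := 4) (y := 5) (P := .put 3 (addr 4 5) (entry 4 5)) (s := s)
    (fun c s' => ∀ a b : Fin n, (a : ℕ) * n + b < c →
      s'.arr 3 (a * n + b) = s.arr 0 (a * n + b))
    (fun _ _ _ h => h) (fun _ _ _ h => h)
    (by decide) (by decide) (by decide) (fun a b hab => by omega) ?_
  · rw [h.card] at key
    exact key a b (addr_lt a.2 b.2)
  · intro i hi j hj s' hx hy hfv hfa h1 a b hab
    rw [h.card] at hi hj hab h1
    have h2 : Holds s' G := h.of_eq (hfv 0 (by decide)) (hfa 0 (by decide)) (hfa 1 (by decide))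
    rw [addr_lt_succ b.2 hj] at hab
    have h3 := h2.addr_eval (x := 4) (y := 5) (i := ⟨i, hi⟩) (j := ⟨j, hj⟩) hx hy
    simp only at h3
    simp only [run, Store.setArr_arr, true_and, h3, addr_inj b.2 hj, entry, Expr.eval]
    split_ifs with h4
    · rw [hfa 0 (by decide), h4.1, h4.2]
    · exact h1 a b (hab.resolve_right h4)

theorem countBelow_lt {n : ℕ} {p : Fin n → Prop} {a : Fin n} (ha : p a) :
    countBelow p a < countBelow p n :=
  @Nat.count_strict_mono _ (Classical.decPred _) _ _ ((natPred_coe a).2 ha) a.2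

theorem countBelow_inj {n : ℕ} {p : Fin n → Prop} {a b : Fin n} (ha : p a) (hb : p b)
    (h : countBelow p a = countBelow p b) : a = b :=
  Fin.ext (@Nat.count_injective _ (Classical.decPred _) _ _ ((natPred_coe a).2 ha)
    ((natPred_coe b).2 hb) h)

/-- Write the entries of the matrix in array `3` at marked positions to their new positions. -/
def compactProg : LoopProg :=
  .loop 4 (.loop 5 (.ite (.get 2 (.var 4)) (.ite (.get 2 (.var 5))
    (.put 0 (.add (.get 5 (.get 4 (.var 4))) (.get 4 (.var 5))) (.get 3 (addr 4 5)))
    .skip) .skip))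

theorem compactProg_spec {n m : ℕ} {s : Store} {p : Fin n → Prop} (hn : s.var 0 = n)
    (hm : m = countBelow p n) (hrow : ∀ i < n, s.arr 1 i = i * n)
    (hrow' : ∀ i < m, s.arr 5 i = i * m) (hp : ∀ v : Fin n, s.arr 2 v ≠ 0 ↔ p v)
    (hidx : ∀ v : Fin n, p v → s.arr 4 v = countBelow p v) (a b : Fin n) (ha : p a) (hb : p b) :
    (compactProg.run s).arr 0 (countBelow p a * m + countBelow p b) = s.arr 3 (a * n + b) := by
  have key := run_loop_loop (x := 4) (y := 5) (P := .ite (.get 2 (.var 4)) (.ite (.get 2 (.var 5))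
      (.put 0 (.add (.get 5 (.get 4 (.var 4))) (.get 4 (.var 5))) (.get 3 (addr 4 5)))
      .skip) .skip) (s := s)
    (fun c s' => ∀ a b : Fin n, (a : ℕ) * n + b < c → p a → p b →
      s'.arr 0 (countBelow p a * m + countBelow p b) = s.arr 3 (a * n + b))
    (fun _ _ _ h => h) (fun _ _ _ h => h)
    (by decide) (by decide) (by decide) (fun a b hab => by omega) ?_
  · rw [hn] at key
    exact key a b (addr_lt a.2 b.2) ha hb
  · clear ha hb a b
    intro i hi j hj s' hx hy hfv hfa h1 a b hab ha hb
    rw [hn] at hi hj hab h1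
    have f1 : s'.arr 1 = s.arr 1 := hfa 1 (by decide)
    have f2 : s'.arr 2 = s.arr 2 := hfa 2 (by decide)
    have f3 : s'.arr 3 = s.arr 3 := hfa 3 (by decide)
    have f4 : s'.arr 4 = s.arr 4 := hfa 4 (by decide)
    have f5 : s'.arr 5 = s.arr 5 := hfa 5 (by decide)
    rw [addr_lt_succ b.2 hj] at hab
    have hpi := hp ⟨i, hi⟩
    have hpj := hp ⟨j, hj⟩
    simp only at hpi hpj
    simp only [run, Expr.eval, hx, hy, f1, f2, f3, f4, f5, addr, hrow i hi]
    split_ifs with c1 c2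
    · rw [hpi] at c1
      rw [hpj] at c2
      have e1 := hidx ⟨i, hi⟩ c1
      have e2 := hidx ⟨j, hj⟩ c2
      simp only at e1 e2
      have l1 : countBelow p i < m := hm ▸ countBelow_lt c1
      have l2 : countBelow p j < m := hm ▸ countBelow_lt c2
      have l3 : countBelow p b < m := hm ▸ countBelow_lt hb
      simp only [e1, e2, hrow' _ l1, Store.setArr_arr, true_and, addr_inj l3 l2]
      split_ifs with h4
      · have h5 : a = ⟨i, hi⟩ := countBelow_inj ha c1 h4.1
        have h6 : b = ⟨j, hj⟩ := countBelow_inj hb c2 h4.2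
        rw [h5, h6]
      · refine h1 a b (hab.resolve_right ?_) ha hb
        rintro ⟨h5, h6⟩
        exact h4 ⟨by rw [h5], by rw [h6]⟩
    · refine h1 a b (hab.resolve_right ?_) ha hb
      rintro ⟨h5, h6⟩
      rw [show b = ⟨j, hj⟩ from Fin.ext h6] at hb
      exact c2 (hpj.2 hb)
    · refine h1 a b (hab.resolve_right ?_) ha hb
      rintro ⟨h5, h6⟩
      rw [show a = ⟨i, hi⟩ from Fin.ext h5] at ha
      exact c1 (hpi.2 ha)

/-- Write the subgraph that the marked vertices induce to array `0`. -/
def outputProg : LoopProg := .seq (rowsProg 5 15) (.seq copyProg compactProg)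

open Classical in
theorem outputProg_spec {n : ℕ} {s : Store} {G : SimpleGraph (Fin n)} (h : Holds s G)
    (hm : s.var 15 = countBelow (marked n s) n)
    (hidx : ∀ v : Fin n, marked n s v → s.arr 4 v = countBelow (marked n s) v)
    (a b : Fin n) (ha : marked n s a) (hb : marked n s b) :
    (outputProg.run s).arr 0
        (countBelow (marked n s) a * s.var 15 + countBelow (marked n s) b) =
      if G.Adj a b then 1 else 0 := by
  set s1 := (rowsProg 5 15).run s with hs1
  set s2 := copyProg.run s1 with hs2
  have h1 : Holds s1 G := h.frame _ (by decide) (by decide) (by decide)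
  have h2 : Holds s2 G := h1.frame _ (by decide) (by decide) (by decide)
  have hle : s.var 15 ≤ n := by
    rw [hm, countBelow_eq_ncard]
    exact (Set.ncard_le_card _).trans_eq (Nat.card_fin n)
  have e5 : s2.arr 5 = s1.arr 5 := (run_frame copyProg s1).2 5 (by decide)
  have e2 : s2.arr 2 = s.arr 2 := ((run_frame copyProg s1).2 2 (by decide)).trans
    ((run_frame _ s).2 2 (by decide))
  have e4 : s2.arr 4 = s.arr 4 := ((run_frame copyProg s1).2 4 (by decide)).trans
    ((run_frame _ s).2 4 (by decide))
  have key := compactProg_spec (s := s2) (p := marked n s) h2.card hm h2.row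
    (fun i hi => by
      rw [e5]
      exact rowsProg_spec s 5 15 (by decide) i (by rw [h.card]; omega))
    (fun v => by rw [e2]; rfl) (fun v hv => by rw [e4]; exact hidx v hv) a b ha hb
  rw [copyProg_spec h1, h1.adj] at key
  exact key

open Classical in
theorem Instance.store_arr (J : Instance) (i j : Fin J.n) :
    J.store.arr 0 (i * J.n + j) = if J.graph.Adj i j then 1 else 0 := by
  have : (∃ a b : Fin J.n, (i : ℕ) * J.n + j = (a : ℕ) * J.n + b ∧ J.graph.Adj a b) ↔
      J.graph.Adj i j := by
    constructor
    · rintro ⟨a, b, h, hab⟩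
      rw [addr_inj j.2 b.2, ← Fin.ext_iff, ← Fin.ext_iff] at h
      rwa [h.1, h.2]
    · exact fun h => ⟨i, j, rfl, h⟩
  simp only [Instance.store, true_and, this]

theorem represents_iff (s : Store) (J : Instance) : Represents s J ↔
    s.var 0 = J.n ∧ s.var 1 = J.k ∧
      ∀ i j : Fin J.n, s.arr 0 (i * J.n + j) = J.store.arr 0 (i * J.n + j) := by
  refine and_congr_right fun _ => and_congr_right fun _ => ⟨fun h i j => h _ (addr_lt i.2 j.2), ?_⟩
  intro h c hc
  have hn : 0 < J.n := Nat.pos_of_ne_zero fun h0 => by simp [h0] at hc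
  have := h ⟨c / J.n, Nat.div_lt_of_lt_mul hc⟩ ⟨c % J.n, Nat.mod_lt _ hn⟩
  rwa [Nat.div_add_mod'] at this

open Classical in
/-- A store with the subgraph that `p` induces, relabelled in increasing order. -/
theorem exists_represents {n : ℕ} {s : Store} {G : SimpleGraph (Fin n)} (p : Fin n → Prop)
    (hn : s.var 0 = countBelow p n)
    (h : ∀ a b : Fin n, p a → p b → s.arr 0 (countBelow p a * countBelow p n + countBelow p b) =
      if G.Adj a b then 1 else 0) :
    ∃ J : Instance, Represents s J ∧ J.n = countBelow p n ∧ J.k = s.var 1 ∧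
      Nonempty (G.induce {v | p v} ≃g J.graph) := by
  let φ : {v : Fin n | p v} → Fin (countBelow p n) := fun v => ⟨countBelow p v, countBelow_lt v.2⟩
  have hφ : Function.Bijective φ := by
    rw [Nat.bijective_iff_injective_and_card]
    refine ⟨fun a b hab => Subtype.ext (countBelow_inj a.2 b.2 (Fin.ext_iff.1 hab)), ?_⟩
    rw [Nat.card_fin, countBelow_eq_ncard, Nat.card_coe_set_eq]
  let e := Equiv.ofBijective φ hφ
  let J : Instance := ⟨countBelow p n, (G.induce {v | p v}).map e, s.var 1⟩
  let ι : G.induce {v | p v} ≃g J.graph := SimpleGraph.Iso.map e _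
  refine ⟨J, ?_, rfl, rfl, ⟨ι⟩⟩
  rw [represents_iff]
  refine ⟨hn, rfl, fun i j => ?_⟩
  rw [J.store_arr]
  obtain ⟨a, rfl⟩ := ι.surjective i
  obtain ⟨b, rfl⟩ := ι.surjective j
  have h1 : J.graph.Adj (ι a) (ι b) ↔ G.Adj a b := ι.map_rel_iff
  have h2 := h a b a.2 b.2
  by_cases hab : G.Adj a b
  · rw [if_pos hab] at h2
    rw [if_pos (h1.2 hab)]
    exact h2
  · rw [if_neg hab] at h2
    rw [if_neg (fun h => hab (h1.1 h))]
    exact h2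

/-! ### The bound on the number of vertices -/

/-- Set variable `y` to the product of variable `x` and the minimum of the parameter and the number
of vertices. -/
def mulMinProg (y x : ℕ) : LoopProg :=
  .seq (.assign y (.const 0)) (.loop 12 (.ite (.sub (.var 1) (.var 12))
    (.assign y (.add (.var y) (.var x))) .skip))

theorem mulMinProg_spec (s : Store) {y x : ℕ} (hy : y ≠ 0 ∧ y ≠ 1 ∧ y ≠ 12)
    (hx : x ≠ 12 ∧ x ≠ y) :
    ((mulMinProg y x).run s).var y = s.var x * min (s.var 1) (s.var 0) := by
  have h0 : (s.setVar y 0).var 0 = s.var 0 := by simp [hy.1.symm]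
  have key := run_loop (x := 12) (s := s.setVar y 0)
    (P := .ite (.sub (.var 1) (.var 12)) (.assign y (.add (.var y) (.var x))) .skip)
    (fun c s' => s'.var y = s.var x * min (s.var 1) c)
    (fun _ _ _ h => by simpa [hy.2.2] using h) (by simp) ?_
  · rw [h0] at key
    exact key
  · intro i hi s' hi' hfv _ h1
    have f1 : s'.var 1 = s.var 1 := by
      rw [hfv 1 (by simp [vars, hy.2.1.symm])]
      simp [hy.2.1.symm]
    have fx : s'.var x = s.var x := by
      rw [hfv x (by simp [vars, hx])]
      simp [hx.2]
    simp only [run, Expr.eval, hi', f1, fx]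
    split_ifs with c1
    · rw [Store.setVar_var, if_pos rfl, h1, min_eq_right (by omega), min_eq_right (by omega),
        Nat.mul_succ]
    · rw [h1, min_eq_left (by omega), min_eq_left (by omega)]

/-- Set variable `19` to four times the cube of the minimum of the parameter and the number of
vertices. -/
def boundProg : LoopProg :=
  .seq (.assign 16 (.const 4)) (.seq (mulMinProg 17 16) (.seq (mulMinProg 18 17)
    (mulMinProg 19 18)))

theorem boundProg_spec (s : Store) :
    (boundProg.run s).var 19 = 4 * min (s.var 1) (s.var 0) ^ 3 := by
  set s1 := s.setVar 16 4 with hs1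
  set s2 := (mulMinProg 17 16).run s1 with hs2
  set s3 := (mulMinProg 18 17).run s2 with hs3
  have h1 := mulMinProg_spec s1 (y := 17) (x := 16) (by decide) (by decide)
  have h2 := mulMinProg_spec s2 (y := 18) (x := 17) (by decide) (by decide)
  have h3 := mulMinProg_spec s3 (y := 19) (x := 18) (by decide) (by decide)
  have a0 : s1.var 0 = s.var 0 := by simp [hs1]
  have a1 : s1.var 1 = s.var 1 := by simp [hs1]
  have a16 : s1.var 16 = 4 := by simp [hs1]
  have b0 : s2.var 0 = s.var 0 := ((run_frame _ s1).1 0 (by decide)).trans a0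
  have b1 : s2.var 1 = s.var 1 := ((run_frame _ s1).1 1 (by decide)).trans a1
  have c0 : s3.var 0 = s.var 0 := ((run_frame _ s2).1 0 (by decide)).trans b0
  have c1 : s3.var 1 = s.var 1 := ((run_frame _ s2).1 1 (by decide)).trans b1
  rw [a0, a1, a16] at h1
  rw [b0, b1, h1] at h2
  rw [c0, c1, h2] at h3
  exact h3.trans (by ring)

theorem two_mul_add_choose_le (k : ℕ) : 2 * k + (k + 1) * (2 * k).choose 2 ≤ 4 * k ^ 3 := by
  have h : (2 * k).choose 2 = k * (2 * k - 1) := by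
    rw [Nat.choose_two_right, mul_assoc, Nat.mul_div_cancel_left _ two_pos]
  rw [h]
  rcases k with _ | k
  · simp
  · have : 2 * (k + 1) - 1 = 2 * k + 1 := by omega
    rw [this]
    nlinarith [Nat.zero_le k, Nat.zero_le (k ^ 2), Nat.zero_le (k ^ 3)]

theorem Irreducible.card_nonisolated_le {n : ℕ} {G : SimpleGraph (Fin n)} {k : ℕ}
    (h : Irreducible G k) (hyes : Identifiable Forest k (Fin n) G) :
    {v | ¬ G.IsIsolated v}.ncard ≤ 4 * k ^ 3 := by
  refine (IdKernel.card_nonisolated_le G k ?_ ?_ hyes).trans (two_mul_add_choose_le k)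
  · intro e
    induction e with
    | _ x y => exact fun he hb => h x y (Or.inl ⟨he, hb⟩)
  · intro u v huv
    by_contra hlt
    rw [not_le] at hlt
    obtain ⟨k', hk', -⟩ := (forest_identify_iff G k huv hlt).1 hyes
    exact h u v (Or.inr ⟨by omega, huv, hlt⟩)

/-! ### The kernelization algorithm -/

/-- The triangle with the parameter `0`, a no-instance of both problems. -/
def noInstance : Instance := ⟨3, ⊤, 0⟩

theorem not_isAcyclic_noInstance : ¬ noInstance.graph.IsAcyclic := fun h =>
  SimpleGraph.IsContained.not_cliqueFree (n := 3) (G := noInstance.graph)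
    ⟨SimpleGraph.Copy.id (⊤ : SimpleGraph (Fin 3))⟩ (h.cliqueFree le_rfl)

theorem not_forest_noInstance :
    ¬ Identifiable Forest noInstance.k (Fin noInstance.n) noInstance.graph :=
  not_isAcyclic_noInstance

theorem not_tree_noInstance :
    ¬ Identifiable Tree noInstance.k (Fin noInstance.n) noInstance.graph :=
  fun h => not_isAcyclic_noInstance (SimpleGraph.IsTree.isAcyclic h)

theorem connected_noInstance : noInstance.graph.Connected :=
  SimpleGraph.connected_top (V := Fin 3)

/-- Write the constant `c` at index `i` of the adjacency matrix. -/
def putConst (i c : ℕ) : LoopProg := .put 0 (.const i) (.const c)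

/-- Output the triangle. -/
def noProg : LoopProg :=
  .seq (.assign 1 (.const 0)) (.seq (.assign 15 (.const 3))
    (.seq (putConst 0 0) (.seq (putConst 1 1) (.seq (putConst 2 1)
    (.seq (putConst 3 1) (.seq (putConst 4 0) (.seq (putConst 5 1)
    (.seq (putConst 6 1) (.seq (putConst 7 1) (putConst 8 0))))))))))

theorem noProg_spec (s : Store) :
    Represents ((noProg.run s).setVar 0 ((noProg.run s).var 15)) noInstance := by
  rw [represents_iff]
  refine ⟨?_, ?_, fun i j => ?_⟩
  · simp [noProg, putConst, run, Expr.eval, noInstance]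
  · simp [noProg, putConst, run, Expr.eval, noInstance]
  · rw [Instance.store_arr]
    have hij : noInstance.graph.Adj i j ↔ i ≠ j := SimpleGraph.top_adj i j
    have e : ∀ i j : Fin 3, (i ≠ j → (noProg.run s).arr 0 (i * 3 + j) = 1) ∧
        (i = j → (noProg.run s).arr 0 (i * 3 + j) = 0) := by
      intro i j
      fin_cases i <;> fin_cases j <;> simp [noProg, putConst, run, Expr.eval]
    by_cases h : noInstance.graph.Adj i j
    · rw [if_pos h]
      exact (e i j).1 (hij.1 h)
    · rw [if_neg h]
      exact (e i j).2 (not_not.1 fun h' => h (hij.2 h'))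

/-- The part of the algorithm that both problems share. If variable `14` is not `0`, or if too many
vertices are left, then the output is the triangle. The bound on their number allows for one more
than that on the vertices that are not isolated, because vertex `0` is always kept. -/
def coreProg : LoopProg :=
  .seq saturateProg (.seq connectProg (.seq (.assign 6 (.const 0)) (.seq reachProg
    (.seq indexProg (.seq boundProg
      (.ite (.add (.var 14) (.sub (.var 15) (.add (.var 19) (.const 1)))) noProg outputProg))))))

theorem outputProg_represents {n : ℕ} {s : Store} {G : SimpleGraph (Fin n)} (h : Holds s G)
    (hm : s.var 15 = countBelow (marked n s) n)
    (hidx : ∀ v : Fin n, marked n s v → s.arr 4 v = countBelow (marked n s) v) :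
    ∃ J : Instance, Represents ((outputProg.run s).setVar 0 ((outputProg.run s).var 15)) J ∧
      J.n = s.var 15 ∧ J.k = s.var 1 ∧ Nonempty (G.induce {v | marked n s v} ≃g J.graph) := by
  have e15 : (outputProg.run s).var 15 = s.var 15 := (run_frame outputProg s).1 15 (by decide)
  have e1 : (outputProg.run s).var 1 = s.var 1 := (run_frame outputProg s).1 1 (by decide)
  obtain ⟨J, h1, h2, h3, h4⟩ := exists_represents (G := G)
    (s := (outputProg.run s).setVar 0 ((outputProg.run s).var 15)) (marked n s)
    (by simp [e15, hm]) (fun a b ha hb => by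
      have := outputProg_spec h hm hidx a b ha hb
      rw [hm] at this
      exact this)
  exact ⟨J, h1, h2.trans hm.symm, by simpa [e1] using h3, h4⟩

/-- The output is small and connected, and equivalent to the input for Forest-Identification, unless
variable `14` forces the triangle. -/
theorem coreProg_spec {n : ℕ} {s : Store} {G : SimpleGraph (Fin n)} (h : Holds s G) :
    ∃ J : Instance, Represents ((coreProg.run s).setVar 0 ((coreProg.run s).var 15)) J ∧
      J.k ≤ s.var 1 ∧ J.n ≤ 4 * s.var 1 ^ 3 + 3 ∧ (0 < n → J.graph.Connected) ∧
      (s.var 14 ≠ 0 → J = noInstance) ∧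
      (s.var 14 = 0 → (Identifiable Forest J.k (Fin J.n) J.graph ↔
        Identifiable Forest (s.var 1) (Fin n) G)) := by
  obtain ⟨G1, H1, S1, I1⟩ := saturateProg_spec h
  set s1 := saturateProg.run s with hs1
  obtain ⟨G2, H2, S2, C2⟩ := connectProg_spec H1 (s1.var 1)
  set s2 := connectProg.run s1 with hs2
  set s3 := reachProg.run (s2.setVar 6 0) with hs3
  have H2' : Holds (s2.setVar 6 0) G2 := H2.setVar (by decide) _
  have H3 : Holds s3 G2 := H2'.frame _ (by decide) (by decide) (by decide)
  set s4 := indexProg.run s3 with hs4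
  have H4 : Holds s4 G2 := H3.frame _ (by decide) (by decide) (by decide)
  obtain ⟨X1, X2⟩ := indexProg_spec H3.card
  set s5 := boundProg.run s4 with hs5
  have H5 : Holds s5 G2 := H4.frame _ (by decide) (by decide) (by decide)
  have B := boundProg_spec s4
  have hrun : coreProg.run s =
      if s5.var 14 + (s5.var 15 - (s5.var 19 + 1)) ≠ 0 then noProg.run s5
      else outputProg.run s5 := rfl
  -- the values that the later phases do not change
  have e2 : s5.arr 2 = s3.arr 2 := ((run_frame boundProg s4).2 2 (by decide)).trans
    ((run_frame indexProg s3).2 2 (by decide))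
  have e4 : s5.arr 4 = s4.arr 4 := (run_frame boundProg s4).2 4 (by decide)
  have e15 : s5.var 15 = s4.var 15 := (run_frame boundProg s4).1 15 (by decide)
  have e1' : s3.var 1 = s1.var 1 := by
    rw [hs3, (run_frame reachProg _).1 1 (by decide), Store.setVar_var, if_neg (by decide),
      hs2, (run_frame connectProg _).1 1 (by decide)]
  have e1'' : s4.var 1 = s1.var 1 := ((run_frame indexProg s3).1 1 (by decide)).trans e1'
  have e1 : s5.var 1 = s1.var 1 := ((run_frame boundProg s4).1 1 (by decide)).trans e1''
  have e14 : s5.var 14 = s.var 14 := by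
    rw [hs5, (run_frame boundProg _).1 14 (by decide), hs4,
      (run_frame indexProg _).1 14 (by decide), hs3, (run_frame reachProg _).1 14 (by decide),
      Store.setVar_var, if_neg (by decide), hs2, (run_frame connectProg _).1 14 (by decide), hs1,
      (run_frame saturateProg _).1 14 (by decide)]
  have em : marked n s5 = marked n s3 := by funext v; rw [marked, marked, e2]
  have hm : s5.var 15 = countBelow (marked n s3) n := e15.trans X1
  have hreach : ∀ z : Fin n, (z : ℕ) = 0 → ∀ v, marked n s3 v ↔ G2.Reachable z v := fun z hz v =>
    reachProg_spec H2' (by simp [hz]) v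
  -- besides the vertex `0`, only vertices that were not isolated after the reductions are marked
  have hmle : countBelow (marked n s3) n ≤ {v | ¬ G1.IsIsolated v}.ncard + 1 := by
    rw [countBelow_eq_ncard]
    rcases Nat.eq_zero_or_pos n with rfl | hn
    · simp [Set.eq_empty_of_isEmpty]
    · let z : Fin n := ⟨0, hn⟩
      refine (Set.ncard_le_ncard (t := insert z {v | ¬ G1.IsIsolated v}) ?_
        (Set.toFinite _)).trans (Set.ncard_insert_le _ _)
      intro v hv
      rcases eq_or_ne v z with hvz | hvz
      · exact Or.inl hvz
      · have hr := (hreach z rfl v).1 hv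
        refine (C2 z rfl v fun hiso => ?_).2
        obtain ⟨w, hw⟩ := hr.nonempty_neighborSet_right hvz.symm
        exact hiso w hw
  have hsafe : Safe G (s.var 1) G2 (s1.var 1) := S1.trans S2
  have hpow : 4 * s1.var 1 ^ 3 ≤ 4 * s.var 1 ^ 3 :=
    Nat.mul_le_mul_left _ (Nat.pow_le_pow_left S1.1 3)
  have h19 : s5.var 19 = 4 * min (s1.var 1) n ^ 3 := by rw [B, e1'', H4.card]
  rw [hrun]
  by_cases c : s5.var 14 + (s5.var 15 - (s5.var 19 + 1)) ≠ 0
  · rw [if_pos c]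
    refine ⟨noInstance, noProg_spec s5, Nat.zero_le _, Nat.le_add_left _ _,
      fun _ => connected_noInstance, fun _ => rfl, fun h14 => ?_⟩
    refine iff_of_false not_forest_noInstance fun hyes => ?_
    rw [← S1.2] at hyes
    have hle := I1.card_nonisolated_le hyes
    have hlen : countBelow (marked n s3) n ≤ n := by
      rw [countBelow_eq_ncard]
      exact (Set.ncard_le_card _).trans_eq (Nat.card_fin n)
    rw [e14, h14, h19, hm] at c
    rcases le_total (s1.var 1) n with h5 | h5
    · rw [min_eq_left h5] at c
      omega
    · rw [min_eq_right h5] at c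
      have : n ≤ n ^ 3 := Nat.le_self_pow (by decide) n
      omega
  · rw [if_neg c]
    obtain ⟨J, J1, J2, J3, ⟨ι⟩⟩ := outputProg_represents H5 (by rw [em, hm])
      (fun v hv => by rw [em] at hv ⊢; rw [e4]; exact X2 v hv)
    rw [em] at ι
    have hmin : min (s1.var 1) n ^ 3 ≤ s1.var 1 ^ 3 := Nat.pow_le_pow_left (min_le_left _ _) 3
    refine ⟨J, J1, ?_, ?_, ?_, ?_, ?_⟩
    · rw [J3, e1]
      exact S1.1
    · rw [J2]
      omega
    · intro hn
      rw [← ι.connected_iff, SimpleGraph.connected_iff_exists_forall_reachable]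
      let z : Fin n := ⟨0, hn⟩
      have hz : marked n s3 z := (hreach z rfl z).2 .rfl
      refine ⟨⟨z, hz⟩, fun v => ?_⟩
      -- a walk from the vertex `0` stays in the set of marked vertices
      have := reachable_induct (G := G2) (u := z) (v := v) (P := fun w => ∃ hw : marked n s3 w,
        (G2.induce {v | marked n s3 v}).Reachable ⟨z, hz⟩ ⟨w, hw⟩)
        ((hreach z rfl v).1 v.2) ⟨hz, .rfl⟩ fun x y hxy ⟨hx, hr⟩ => by
          refine ⟨(hreach z rfl y).2 (((hreach z rfl x).1 hx).trans hxy.reachable),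
            hr.trans (SimpleGraph.Adj.reachable ?_)⟩
          exact hxy
      exact this.2
    · intro h14
      exact (c (by rw [e14]; omega)).elim
    · intro _
      rw [J3, e1, ← forest_iso_iff ι, ← hsafe.2]
      refine (forest_induce_iff G2 _ _ fun v hv => ?_).symm
      by_contra hiso
      let z : Fin n := ⟨0, lt_of_le_of_lt (Nat.zero_le _) v.2⟩
      exact hv ((hreach z rfl v).2 (C2 z rfl v hiso).1)

theorem eval_le_eval {p : Polynomial ℕ} {a b : ℕ} (h : a ≤ b) : p.eval a ≤ p.eval b := by
  rw [Polynomial.eval_eq_sum, Polynomial.eval_eq_sum]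
  exact Finset.sum_le_sum fun i _ => Nat.mul_le_mul_left _ (Nat.pow_le_pow_left h i)

/-- A loop program that computes small equivalent instances yields a kernel. -/
theorem admitsKernel_of_loopProg {L : Set Instance} (P : LoopProg) (hP : P.WF) (h0 : 0 ∉ P.vars)
    (h : ∀ I : Instance, ∃ J : Instance,
      Represents ((P.run I.store).setVar 0 ((P.run I.store).var 15)) J ∧
      (J ∈ L ↔ I ∈ L) ∧ J.n ≤ 4 * I.k ^ 3 + 3 ∧ J.k ≤ I.k) :
    AdmitsKernelWithVertices L fun k => (k : ℝ) ^ 3 := by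
  choose A hA hL hn hk using h
  refine ⟨fun k => 4 * k ^ 3 + 3, ?_, A, ⟨?_, hL, hn, hk⟩⟩
  · refine Asymptotics.IsBigO.of_bound 7 ?_
    filter_upwards [Filter.eventually_ge_atTop 1] with k hk
    have h1 : (1 : ℝ) ≤ (k : ℝ) ^ 3 := one_le_pow₀ (by exact_mod_cast hk)
    rw [Real.norm_of_nonneg (by positivity), Real.norm_of_nonneg (by positivity)]
    push_cast
    linarith
  · refine ⟨.seq P.compile (.assign 0 (.var 15)), P.cost + 2, fun I => ?_⟩
    obtain ⟨t, he, ht⟩ := exec_compile P hP I.store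
    refine ⟨_, _, .seq he (.assign 0 (.var 15) _), ?_, hA I⟩
    have h1 : I.store.var 0 = I.n := by simp [Instance.store]
    have h2 : I.n ≤ I.size := (Nat.le_mul_self I.n).trans (Nat.le_add_right _ _)
    have h3 := ht h0
    rw [h1] at h3
    have h4 := eval_le_eval (p := P.cost) h2
    simp only [Polynomial.eval_add, Polynomial.eval_ofNat, Expr.cost]
    omega

theorem rowsProg_holds (I : Instance) : Holds ((rowsProg 1 0).run I.store) I.graph := by
  have h0 : I.store.var 0 = I.n := by simp [Instance.store]
  refine ⟨?_, ?_, fun i j => ?_⟩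
  · rw [(run_frame _ _).1 0 (by decide), h0]
  · have := rowsProg_spec I.store 1 0 (by decide)
    rwa [h0] at this
  · rw [(run_frame _ _).2 0 (by decide)]
    exact I.store_arr i j

/-- The kernelization algorithm for Forest-Identification. -/
def forestProg : LoopProg := .seq (rowsProg 1 0) coreProg

theorem admitsKernel_forest :
    AdmitsKernelWithVertices (IdentificationProblem Forest) fun k => (k : ℝ) ^ 3 := by
  refine admitsKernel_of_loopProg forestProg (by decide) (by decide) fun I => ?_
  set s := (rowsProg 1 0).run I.store with hs
  have e1 : s.var 1 = I.k := by
    rw [hs, (run_frame _ _).1 1 (by decide)]; simp [Instance.store]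
  have e14 : s.var 14 = 0 := by
    rw [hs, (run_frame _ _).1 14 (by decide)]; simp [Instance.store]
  have H : Holds s I.graph := rowsProg_holds I
  obtain ⟨J, h1, h2, h3, -, -, h4⟩ := coreProg_spec H
  rw [e1] at h2 h3
  rw [e1] at h4
  have hrun : forestProg.run I.store = coreProg.run s := by rw [forestProg, run]
  rw [hrun]
  exact ⟨J, h1, h4 e14, h3, h2⟩

/-- Compare the number of components with the parameter: set variable `14` if the parameter is too
small to connect the graph, or if there is no vertex, and otherwise reduce the parameter. -/
def parameterProg : LoopProg :=
  .ite (.var 0) (.seq (.assign 14 (.sub (.var 21) (.add (.var 1) (.const 1))))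
    (.assign 1 (.sub (.add (.var 1) (.const 1)) (.var 21)))) (.assign 14 (.const 1))

/-- The kernelization algorithm for Tree-Identification. -/
def treeProg : LoopProg :=
  .seq (rowsProg 1 0) (.seq componentsProg (.seq parameterProg coreProg))

theorem admitsKernel_tree :
    AdmitsKernelWithVertices (IdentificationProblem Tree) fun k => (k : ℝ) ^ 3 := by
  refine admitsKernel_of_loopProg treeProg (by decide) (by decide) fun I => ?_
  set s := (rowsProg 1 0).run I.store with hs
  have H : Holds s I.graph := rowsProg_holds I
  set s1 := componentsProg.run s with hs1
  have H1 : Holds s1 I.graph := H.frame _ (by decide) (by decide) (by decide)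
  have hc : s1.var 21 = Nat.card I.graph.ConnectedComponent := componentsProg_spec H
  have e1 : s1.var 1 = I.k := by
    rw [hs1, (run_frame componentsProg _).1 1 (by decide), hs, (run_frame _ _).1 1 (by decide)]
    simp [Instance.store]
  set s2 := parameterProg.run s1 with hs2
  have H2 : Holds s2 I.graph := H1.frame _ (by decide) (by decide) (by decide)
  obtain ⟨J, h1, h2, h3, h4, h5, h6⟩ := coreProg_spec H2
  have hrun : treeProg.run I.store = coreProg.run s2 := by
    rw [treeProg, run, run, run]
  rw [hrun]
  refine ⟨J, h1, ?_⟩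
  have htree := tree_iff_forest I.graph I.k
  rcases Nat.eq_zero_or_pos I.n with hn | hn
  · have e14 : s2.var 14 = 1 := by
      rw [hs2, parameterProg, run, if_neg (by simp [Expr.eval, H1.card, hn])]
      simp [run, Expr.eval]
    rw [h5 (by omega)]
    refine ⟨iff_of_false not_tree_noInstance fun hI => ?_, Nat.le_add_left _ _, Nat.zero_le _⟩
    obtain ⟨⟨v⟩, -⟩ := htree.1 hI
    have := v.2
    omega
  · have hrun : s2 = (s1.setVar 14 (s1.var 21 - (s1.var 1 + 1))).setVar 1
        (s1.var 1 + 1 - s1.var 21) := by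
      rw [hs2, parameterProg, run, if_pos (by simp [Expr.eval, H1.card]; omega)]
      simp [run, Expr.eval]
    have e14 : s2.var 14 = Nat.card I.graph.ConnectedComponent - (I.k + 1) := by
      rw [hrun]; simp [hc, e1]
    have e1' : s2.var 1 = I.k + 1 - Nat.card I.graph.ConnectedComponent := by
      rw [hrun]; simp [hc, e1]
    have : Nonempty (Fin I.n) := ⟨⟨0, hn⟩⟩
    have hpos : 0 < Nat.card I.graph.ConnectedComponent := by
      have : Nonempty I.graph.ConnectedComponent := ⟨I.graph.connectedComponentMk ⟨0, hn⟩⟩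
      exact Nat.card_pos
    have hk : s2.var 1 ≤ I.k := by omega
    refine ⟨?_, h3.trans ?_, h2.trans hk⟩
    · by_cases hle : Nat.card I.graph.ConnectedComponent ≤ I.k + 1
      · have h7 := h6 (by omega)
        rw [← tree_iff_forest_of_connected _ (h4 hn), e1'] at h7
        exact h7.trans ⟨fun h => htree.2 ⟨this, hle, h⟩, fun h => (htree.1 h).2.2⟩
      · rw [h5 (by omega)]
        exact iff_of_false not_tree_noInstance fun hI => hle (htree.1 hI).2.1
    · exact Nat.add_le_add_right (Nat.mul_le_mul_left _ (Nat.pow_le_pow_left hk 3)) 3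

theorem lt_encard_iff {V : Type} [Finite V] (S : Set V) (k : ℕ) :
    (k + 1 : ℕ∞) < S.encard ↔ k + 1 < S.ncard := by
  rw [← (Set.toFinite S).cast_ncard_eq]
  exact_mod_cast Iff.rfl

end IdKernel

theorem mainTheorem3 :
    -- both problems admit a kernel with `O(k ^ 3)` vertices
    IdKernel.AdmitsKernelWithVertices
      (IdKernel.IdentificationProblem IdKernel.Forest) (fun k => (k : ℝ) ^ 3) ∧
    IdKernel.AdmitsKernelWithVertices
      (IdKernel.IdentificationProblem IdKernel.Tree) (fun k => (k : ℝ) ^ 3) ∧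
    -- the reduction rules for forests are safe: deletion of a bridge
    (∀ (V : Type) [Finite V] (G : SimpleGraph V) (k : ℕ) (e : Sym2 V),
      e ∈ G.edgeSet → G.IsBridge e →
      (IdKernel.Identifiable IdKernel.Forest k V G ↔
        IdKernel.Identifiable IdKernel.Forest k V (G.deleteEdges {e}))) ∧
    -- deletion of an isolated vertex
    (∀ (V : Type) [Finite V] (G : SimpleGraph V) (k : ℕ) (v : V),
      G.IsIsolated v →
      (IdKernel.Identifiable IdKernel.Forest k V G ↔
        IdKernel.Identifiable IdKernel.Forest k {x : V // x ≠ v} (G.induce {x | x ≠ v}))) ∧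
    -- identification of two vertices with more than `k + 1` common neighbours
    (∀ (V : Type) [Finite V] (G : SimpleGraph V) (k : ℕ) (u v : V),
      u ≠ v → (k + 1 : ℕ∞) < (G.commonNeighbors u v).encard →
      (IdKernel.Identifiable IdKernel.Forest k V G ↔
        ∃ k' : ℕ, k = k' + 1 ∧
          IdKernel.Identifiable IdKernel.Forest k' {x : V // x ≠ v}
            (IdKernel.identify G u v))) ∧
    -- a yes-instance to which no rule applies is small
    (∀ (V : Type) [Finite V] (G : SimpleGraph V) (k : ℕ),
      IdKernel.IsReduced G k → IdKernel.Identifiable IdKernel.Forest k V G →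
      Nat.card V ≤ 2 * k + (k + 1) * (2 * k).choose 2) := by
  refine ⟨IdKernel.admitsKernel_forest, IdKernel.admitsKernel_tree,
    fun V _ G k e he hb => IdKernel.forest_deleteEdges_iff G k he hb,
    fun V _ G k v hv => IdKernel.forest_induce_iff G k {x | x ≠ v} fun w hw => ?_,
    fun V _ G k u v huv hk => IdKernel.forest_identify_iff G k huv
      ((IdKernel.lt_encard_iff _ k).1 hk),
    fun V _ G k hred hyes => ?_⟩
  · have : w = v := not_not.1 hw
    exact this ▸ hv
  · have h := IdKernel.card_nonisolated_le G k hred.no_bridge (fun u v huv => ?_) hyes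
    · rwa [Set.eq_univ_of_forall (s := {v | ¬ G.IsIsolated v}) hred.no_isolated,
        Set.ncard_univ] at h
    · refine not_lt.1 fun hlt => ?_
      exact absurd ((IdKernel.lt_encard_iff _ k).2 hlt) (not_lt.2 (hred.common_le u v huv))
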